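/- Let $k\ge 1$, $m=2k+2$, $0<\sigma\le\sqrt2$, $g(t)=e^{-t^2/\sigma^2}$, and let $\eta,\epsilon,f_0,f_1,\bar f>0$. Let $t_1<\dots<t_k$ (impulses) satisfy $|t_i-t_j|\ge\Delta$ for $i\ne j$, where $\Delta>\sigma\sqrt{\log(3+4/\sigma^2)}$, and let $\epsilon\le\Delta/2$. Let the sampling points $s_1,\dots,s_m$ satisfy $s_1=0$, $s_m=1$, and $|s_{2i}-t_i|\le\eta$, $s_{2i+1}-s_{2i}=\eta$ for all $i\in\{1,\dots,k\}$. Assume that the $t_i$ ($1\le i\le k$) and the $s_j$ ($2\le j\le m-1$) all lie in $[\sigma\sqrt{\log(1/\eta^3)},\,1-\sigma\sqrt{\log(1/\eta^3)}]$. Define $$F_{\min}=1-\Big(1+\frac2{\sigma^2}\Big)\frac{2e^{-\Delta^2/\sigma^2}}{1-e^{-\Delta^2/\sigma^2}},$$ $$F_{\max}=\Big(8+\Big(1+\frac4{\sigma^4}\Big)\frac{2}{1-e^{-\Delta^2/\sigma^2}}\Big)^{1/2}\Big(32+\Big(\frac1{\sigma^4}+\frac2{\sigma^6}+\frac2{\sigma^8}\Big)\frac{24}{1-e^{-\Delta^2/\sigma^2}}\Big)^{1/2},$$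 $$F(\Delta,1/\sigma)=\frac{F_{\max}}{F_{\min}^2},\qquad \bar C=f_0^2+f_1^2+2f_0+2f_1+2,$$ $$P=\frac4{\sigma^4}+\frac{13}4\Big(\frac2{\sigma^2}+\frac4{\sigma^4}\Big)^2+\frac94\Big(\frac{12}{\sigma^4}+\frac8{\sigma^6}\Big)^2,$$ and assume $\eta\le\sigma^2$, $$\eta^3\Big(4k+4+\frac{4k}{\sigma^2}\Big)\le\sqrt{\bar C},\qquad \eta\le\frac{8F_{\min}}{34(2k+2)\Big(80k+8+kP\,\frac{3}{1-e^{-\Delta^2/\sigma^2}}\Big)^{1/2}}.$$ Let $G:[0,1]\to\mathbb R$ be $f_0$ at $0$, $f_1$ at $1$, $0$ at the other points within distance $\epsilon$ of some $t_i$, and $\bar f$ elsewhere. For $\pi\in\{\pm1\}^k$ let $G^\pi$ be $f_0$ at $0$, $f_1$ at $1$, $\pi_i$ at the other points within distance $\epsilon$ of $t_i$ (at a point within $\epsilon$ of two impulses either choice is allowed), and $-\bar f$ elsewhere. For small $\rho>0$ let $(\tau_1,\dots,\tau_m)=(0,t_1,t_1+\rho,\dots,t_k,t_k+\rho,1)$,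 and for $H\in\{G,G^\pi\}$ let $M^\rho_j(H)$ be the determinant of the $m\times(m+1)$ matrix with rows $(H(\tau_l),g(\tau_l-s_1),\dots,g(\tau_l-s_m))$, $1\le l\le m$, with its $j$-th column deleted. The coefficients of the dual certificate for $H$ are $\lim_{\rho\to0^+}(-1)^{j+1}M^\rho_{j+1}(H)/M^\rho_1(H)$, $j=1,\dots,m$. Then these limits exist, both for $G$ (giving a vector $b\in\mathbb R^m$) and for $G^\pi$ for every sign pattern $\pi$ (giving $b^\pi\in\mathbb R^m$), and $$\|b\|_2\le\frac{\sqrt{(2k+2)\big(4k+5+4k/\sigma^4\big)}}{1-\sqrt e/2}\;\bar C^{5/4}\,F(\Delta,1/\sigma)^k,\qquad \|b^\pi\|_2\le\frac{\sqrt{2k+2}}{\eta\,(1-\sqrt e/2)}\,(\bar C+2k)^{3/2}\,F(\Delta,1/\sigma)^k.$$ -/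

import Mathlib

open Filter Topology

noncomputable section

namespace SuperRes

/-- The Gaussian window `g(t) = exp(-t²/σ²)`. -/
def gaussianWindow (σ t : ℝ) : ℝ := Real.exp (-(t ^ 2 / σ ^ 2))

/-- The function `F` on `[0,1]` that the dual certificate dominates: `f₀` at `0`, `f₁` at `1`,
`0` on the `ε`-neighbourhoods of the impulses, and `fbar` elsewhere. -/
def targetF {k : ℕ} (t : Fin k → ℝ) (ε f₀ f₁ fbar : ℝ) (x : ℝ) : ℝ :=
  open Classical in
  if x = 0 then f₀
  else if x = 1 then f₁
  else if ∃ i, |x - t i| ≤ ε then 0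
  else fbar

/-- The function `F^π` for a sign pattern `π`: `f₀` at `0`, `f₁` at `1`,
`π i` on the `ε`-neighbourhood of the impulse `t i`, and `-fbar` elsewhere. -/
def targetFSign {k : ℕ} (t : Fin k → ℝ) (π : Fin k → ℝ) (ε f₀ f₁ fbar : ℝ) (x : ℝ) : ℝ :=
  open Classical in
  if x = 0 then f₀
  else if x = 1 then f₁
  else if h : ∃ i, |x - t i| ≤ ε then π h.choose
  else -fbar

/-- The interpolation nodes `0, t₁, t₁ + ρ, t₂, t₂ + ρ, …, t_k, t_k + ρ, 1`. -/
def nodes {k : ℕ} (t : Fin k → ℝ) (ρ : ℝ) (l : Fin (2 * k + 2)) : ℝ :=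
  if h₀ : l.val = 0 then 0
  else if h₁ : l.val = 2 * k + 1 then 1
  else if l.val % 2 = 1 then t ⟨(l.val - 1) / 2, by omega⟩
  else t ⟨(l.val - 1) / 2, by omega⟩ + ρ

/-- The `m × (m+1)` matrix with rows `(F(τ_l), φ₁(τ_l), …, φ_m(τ_l))`, where
`φ_j(x) = g(x - s_j)`. -/
def nodeMatrix {m : ℕ} (F g : ℝ → ℝ) (s τ : Fin m → ℝ) : Matrix (Fin m) (Fin (m + 1)) ℝ :=
  Matrix.of fun l => Fin.cons (F (τ l)) (fun j => g (τ l - s j))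

/-- The minor of `nodeMatrix` in which the column `c` is deleted. Equivalently: the minor of the
`(m+1) × (m+1)` matrix with one further row `(F(x), φ₁(x), …, φ_m(x))`, along that row. -/
def nodeMinor {m : ℕ} (F g : ℝ → ℝ) (s τ : Fin m → ℝ) (c : Fin (m + 1)) : ℝ :=
  ((nodeMatrix F g s τ).submatrix id c.succAbove).det

/-- The `j`-th coefficient of the normalised polynomial `-F + ∑ j, b_j φ_j` that vanishes at the
nodes `τ`, as a signed ratio of minors. (With `j` counted from `1` the sign is `(-1)^(j+1)`;
here `j` is counted from `0`.) -/
def certCoeff {m : ℕ} (F g : ℝ → ℝ) (s τ : Fin m → ℝ) (j : Fin m) : ℝ :=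
  (-1) ^ (j : ℕ) * (nodeMinor F g s τ j.succ / nodeMinor F g s τ 0)

/-- `b` is the coefficient vector of the dual certificate for `F` with Gaussian window of
width `σ`, impulses `t` and samples `s`: the limit as `ρ → 0⁺` of the coefficients of the
normalised polynomial that vanishes at `0, t₁, t₁ + ρ, …, t_k, t_k + ρ, 1`. -/
def IsDualCertCoeff {k : ℕ} (F : ℝ → ℝ) (σ : ℝ) (t : Fin k → ℝ) (s : Fin (2 * k + 2) → ℝ)
    (b : EuclideanSpace ℝ (Fin (2 * k + 2))) : Prop :=
  ∀ j, Tendsto (fun ρ : ℝ => certCoeff F (gaussianWindow σ) s (nodes t ρ) j) (𝓝[>] 0) (𝓝 (b j))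

/-- `F_min(Δ, 1/σ)`. -/
def Fmin (Δ σ : ℝ) : ℝ :=
  1 - (1 + 2 / σ ^ 2) *
    (2 * Real.exp (-(Δ ^ 2 / σ ^ 2)) / (1 - Real.exp (-(Δ ^ 2 / σ ^ 2))))

/-- `F_max(Δ, 1/σ)`. -/
def Fmax (Δ σ : ℝ) : ℝ :=
  Real.sqrt (8 + (1 + 4 / σ ^ 4) * (2 / (1 - Real.exp (-(Δ ^ 2 / σ ^ 2))))) *
  Real.sqrt (32 + (1 / σ ^ 4 + 2 / σ ^ 6 + 2 / σ ^ 8) *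
    (24 / (1 - Real.exp (-(Δ ^ 2 / σ ^ 2)))))

/-- `F(Δ, 1/σ) = F_max / F_min²`. -/
def Fratio (Δ σ : ℝ) : ℝ := Fmax Δ σ / Fmin Δ σ ^ 2

/-- `C̄(f₀, f₁)`. -/
def Cbar (f₀ f₁ : ℝ) : ℝ := f₀ ^ 2 + f₁ ^ 2 + 2 * f₀ + 2 * f₁ + 2

/-- The polynomial `P(1/σ)`. -/
def Ppoly (σ : ℝ) : ℝ :=
  4 / σ ^ 4 + 13 / 4 * (2 / σ ^ 2 + 4 / σ ^ 4) ^ 2 + 9 / 4 * (12 / σ ^ 4 + 8 / σ ^ 6) ^ 2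

end SuperRes

end

/-!
The limits of the certificate coefficients are obtained from Cramer's rule: by
`certCoeff_eq_of_mulVec_eq` the coefficients at a given `ρ` solve the interpolation system at the
nodes. Replacing the row at `t_i + ρ` by the difference quotient with the row at `t_i` gives an
equivalent system, which converges, as `ρ → 0⁺`, to the confluent system with rows `g(t_i - s_j)`
and `g'(t_i - s_j)`. If the confluent matrix is invertible, the limits exist and form its solution
(`exists_isDualCertCoeff`).

Invertibility and the norm bounds both come from diagonal dominance in the sup norm, without
estimating any determinant. For a pair of samples `p_i`, `p_i + η` with coefficients `b`, `b'`, take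
`u_i = b + b'` and `v_i = η b'` as unknowns. Up to errors of order `η`, the interior rows then have
the entries `g(t_i - t_j), -g'(t_i - t_j)` and `g'(t_i - t_j), -g''(t_i - t_j)`. The diagonal block
is `diag(1, 2 / σ²)`. After multiplying the second row by `σ² / 2`, the remaining entries of a row
have absolute sum at most `(1 + 2 / σ²) ∑_{j ≠ i} g(t_i - t_j) ≤ 1 - Fmin`, the last step by
comparison with a geometric series. The smallness condition on `η` keeps the perturbation of each
row below `Fmin / 2`, so `‖(u, v)‖_∞ ≤ (2 / Fmin) ‖right-hand side‖_∞`
(`InteriorConfig.abs_unknowns_le`).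

The two end points are coupled to the interior only through values of size `η³`
(`BoundaryConfig.abs_unknowns_le`). For the target that vanishes near the impulses the interior
right-hand side is therefore `O(η³)`, and dividing `v_i` by `η` is harmless: all coefficients are at
most `2 (f₀ + f₁)`. For a sign pattern they are at most `4 (2 + f₀ + f₁) / (η Fmin)`. Both bounds
lie below the asserted ones because `1 / Fmin ≤ Fmax / Fmin² = Fratio ≤ Fratio ^ k`.
-/

namespace SuperRes

/-! ### The Gaussian window and its derivatives -/

/-- The first derivative of the Gaussian window. -/
noncomputable def gaussianDeriv (σ x : ℝ) : ℝ := -(2 * x / σ ^ 2) * gaussianWindow σ x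

/-- The second derivative of the Gaussian window. -/
noncomputable def gaussianDeriv2 (σ x : ℝ) : ℝ :=
  (4 * x ^ 2 / σ ^ 4 - 2 / σ ^ 2) * gaussianWindow σ x

lemma gaussianWindow_pos (σ x : ℝ) : 0 < gaussianWindow σ x := Real.exp_pos _

lemma gaussianWindow_le_one (σ x : ℝ) : gaussianWindow σ x ≤ 1 := by
  unfold gaussianWindow
  rw [Real.exp_le_one_iff]
  have : 0 ≤ x ^ 2 / σ ^ 2 := by positivity
  linarith

lemma gaussianWindow_neg (σ x : ℝ) : gaussianWindow σ (-x) = gaussianWindow σ x := by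
  simp [gaussianWindow]

lemma gaussianWindow_zero (σ : ℝ) : gaussianWindow σ 0 = 1 := by simp [gaussianWindow]

lemma hasDerivAt_gaussianWindow (σ x : ℝ) :
    HasDerivAt (gaussianWindow σ) (gaussianDeriv σ x) x := by
  have h := ((((hasDerivAt_id x).pow 2).div_const (σ ^ 2)).neg).exp
  refine h.congr_deriv ?_
  simp only [gaussianDeriv, gaussianWindow, id, Pi.pow_apply]
  norm_num
  ring

lemma hasDerivAt_gaussianDeriv {σ : ℝ} (x : ℝ) :
    HasDerivAt (gaussianDeriv σ) (gaussianDeriv2 σ x) x := by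
  have h := ((((hasDerivAt_id x).const_mul 2).div_const (σ ^ 2)).neg).mul
    (hasDerivAt_gaussianWindow σ x)
  refine h.congr_deriv ?_
  simp only [gaussianDeriv, gaussianDeriv2, id, Pi.neg_apply]
  ring

lemma hasDerivAt_gaussianDeriv2 {σ : ℝ} (x : ℝ) :
    HasDerivAt (gaussianDeriv2 σ)
      ((12 * x / σ ^ 4 - 8 * x ^ 3 / σ ^ 6) * gaussianWindow σ x) x := by
  have h := (((((hasDerivAt_id x).pow 2).const_mul 4).div_const (σ ^ 4)).sub_const
    (2 / σ ^ 2)).mul (hasDerivAt_gaussianWindow σ x)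
  refine h.congr_deriv ?_
  simp only [gaussianDeriv, id, Pi.pow_apply]
  norm_num
  ring

/-- A common Lipschitz constant on `[-1, 1]` for the Gaussian window of width `σ ≤ √2` and its
first two derivatives; it is the trivial bound for the third derivative. -/
noncomputable def gaussianLip (σ : ℝ) : ℝ := 12 / σ ^ 4 + 8 / σ ^ 6

lemma two_div_sq_le {σ : ℝ} (hσ : 0 < σ) (hσ2 : σ ^ 2 ≤ 2) : 2 / σ ^ 2 ≤ 4 / σ ^ 4 := by
  rw [div_le_div_iff₀ (by positivity) (by positivity)]
  nlinarith [pow_pos hσ 2]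

lemma abs_mul_gaussianWindow_le {σ c K : ℝ} (x : ℝ) (hc : |c| ≤ K) :
    |c * gaussianWindow σ x| ≤ K := by
  rw [abs_mul, abs_of_pos (gaussianWindow_pos σ x)]
  nlinarith [gaussianWindow_pos σ x, gaussianWindow_le_one σ x, abs_nonneg c]

lemma abs_gaussianDeriv_le {σ : ℝ} (hσ : 0 < σ) (hσ2 : σ ^ 2 ≤ 2) {x : ℝ} (hx : |x| ≤ 1) :
    |gaussianDeriv σ x| ≤ gaussianLip σ := by
  apply abs_mul_gaussianWindow_le
  have h1 := two_div_sq_le hσ hσ2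
  have h2 : |-(2 * x / σ ^ 2)| ≤ 2 / σ ^ 2 := by
    rw [abs_neg, abs_div, abs_of_pos (pow_pos hσ 2), abs_mul, abs_two]
    gcongr
    linarith
  have h3 : 0 < 8 / σ ^ 6 := by positivity
  have h4 : 4 / σ ^ 4 ≤ 12 / σ ^ 4 := by gcongr; norm_num
  unfold gaussianLip
  linarith

lemma abs_gaussianDeriv2_le {σ : ℝ} (hσ : 0 < σ) (hσ2 : σ ^ 2 ≤ 2) {x : ℝ} (hx : |x| ≤ 1) :
    |gaussianDeriv2 σ x| ≤ gaussianLip σ := by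
  apply abs_mul_gaussianWindow_le
  have h1 := two_div_sq_le hσ hσ2
  have hx2 : x ^ 2 ≤ 1 := (sq_le_one_iff_abs_le_one x).2 hx
  have h2 : 0 ≤ 4 * x ^ 2 / σ ^ 4 := by positivity
  have h2' : 4 * x ^ 2 / σ ^ 4 ≤ 4 / σ ^ 4 := by gcongr; linarith
  have h3 : 0 < 8 / σ ^ 6 := by positivity
  have h4 : 12 / σ ^ 4 = 3 * (4 / σ ^ 4) := by ring
  have h5 : 0 < 4 / σ ^ 4 := by positivity
  have h6 : 0 < 2 / σ ^ 2 := by positivity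
  unfold gaussianLip
  rw [abs_le]
  constructor <;> linarith

lemma abs_gaussianDeriv3_le {σ : ℝ} (hσ : 0 < σ) {x : ℝ} (hx : |x| ≤ 1) :
    |(12 * x / σ ^ 4 - 8 * x ^ 3 / σ ^ 6) * gaussianWindow σ x| ≤ gaussianLip σ := by
  apply abs_mul_gaussianWindow_le
  have hx3 : |x| ^ 3 ≤ 1 := pow_le_one₀ (abs_nonneg x) hx
  refine (abs_sub _ _).trans ?_
  rw [abs_div, abs_div, abs_mul, abs_mul, abs_pow x 3, abs_of_pos (pow_pos hσ 4),
    abs_of_pos (pow_pos hσ 6), abs_of_pos (show (0 : ℝ) < 12 by norm_num),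
    abs_of_pos (show (0 : ℝ) < 8 by norm_num)]
  unfold gaussianLip
  gcongr <;> linarith

/-- The mean value inequality on `[-1, 1]`. -/
lemma abs_sub_le_of_hasDerivAt {f f' : ℝ → ℝ} {K : ℝ} (hf : ∀ x, HasDerivAt f (f' x) x)
    (hK : ∀ x, |x| ≤ 1 → |f' x| ≤ K) {x y : ℝ} (hx : |x| ≤ 1) (hy : |y| ≤ 1) :
    |f x - f y| ≤ K * |x - y| := by
  have := (convex_Icc (-1 : ℝ) 1).norm_image_sub_le_of_norm_hasDerivWithin_le
    (f := f) (f' := f') (C := K) (fun z _ => (hf z).hasDerivWithinAt)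
    (fun z hz => hK z (abs_le.2 hz)) (abs_le.1 hy) (abs_le.1 hx)
  simpa [Real.norm_eq_abs] using this

/-- A backward difference quotient of `f` differs from `-f'` at a nearby point `z` by
`O(η)`. -/
lemma abs_diffQuot_add_deriv_le {f f' : ℝ → ℝ} {K η x z : ℝ} (hf : ∀ x, HasDerivAt f (f' x) x)
    (hK : ∀ x y, |x| ≤ 1 → |y| ≤ 1 → |f' x - f' y| ≤ K * |x - y|) (hK0 : 0 ≤ K)
    (hη : 0 < η) (hx : |x| ≤ 1) (hxη : |x - η| ≤ 1) (hz : |z| ≤ 1)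
    (hxz : |x - z| ≤ 2 * η) (hxηz : |x - η - z| ≤ 2 * η) :
    |(f (x - η) - f x) / η + f' z| ≤ K * (2 * η) := by
  obtain ⟨c, hc, hfc⟩ := exists_hasDerivAt_eq_slope f f' (sub_lt_self x hη)
    (fun y _ => (hf y).continuousAt.continuousWithinAt) (fun y _ => hf y)
  have h1 : (f (x - η) - f x) / η = -f' c := by
    rw [hfc, sub_sub_cancel]; ring
  rw [h1, neg_add_eq_sub]
  rw [abs_le] at hx hxη hxz hxηz
  have hc1 : |c| ≤ 1 := abs_le.2 ⟨by linarith [hc.1], by linarith [hc.2]⟩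
  refine (hK z c hz hc1).trans (mul_le_mul_of_nonneg_left ?_ hK0)
  rw [abs_sub_comm]
  exact abs_le.2 ⟨by linarith [hc.1], by linarith [hc.2]⟩

/-! ### Separated impulses -/

lemma nat_mul_le_sub_of_separated {k : ℕ} {t : Fin k → ℝ} {Δ : ℝ} (ht : StrictMono t)
    (hΔ : ∀ i j, i ≠ j → Δ ≤ |t i - t j|) (n : ℕ) :
    ∀ i j : Fin k, (i : ℕ) + n = j → n * Δ ≤ t j - t i := by
  induction n with
  | zero =>
    intro i j h
    have : i = j := Fin.ext (by simpa using h)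
    simp [this]
  | succ n ih =>
    intro i j h
    have hl : (i : ℕ) + n < k := by omega
    have h1 := ih i ⟨i + n, hl⟩ rfl
    have hlt : (⟨i + n, hl⟩ : Fin k) < j := by
      rw [Fin.lt_def]; simp only; omega
    have h2 := hΔ j ⟨i + n, hl⟩ hlt.ne'
    rw [abs_of_pos (sub_pos.2 (ht hlt))] at h2
    push_cast
    linarith

/-- The Gaussian at the distance of the `i`-th and `j`-th impulses is at most
`exp (-Δ² / σ²) ^ |i - j|`, because `(nΔ)² ≥ nΔ²`. -/
lemma gaussianWindow_sub_le_pow {k : ℕ} {t : Fin k → ℝ} {Δ σ : ℝ} (hσ : 0 < σ) (hΔ0 : 0 < Δ)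
    (ht : StrictMono t) (hΔ : ∀ i j, i ≠ j → Δ ≤ |t i - t j|) {n : ℕ} {i j : Fin k}
    (h : (i : ℕ) + n = j) :
    gaussianWindow σ (t j - t i) ≤ Real.exp (-(Δ ^ 2 / σ ^ 2)) ^ n := by
  have h1 := nat_mul_le_sub_of_separated ht hΔ n i j h
  rw [← Real.exp_nat_mul, gaussianWindow, Real.exp_le_exp, mul_neg, neg_le_neg_iff, ← mul_div_assoc]
  gcongr
  have h2 : (n : ℝ) ≤ (n : ℝ) ^ 2 := by exact_mod_cast Nat.le_self_pow two_ne_zero n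
  have h3 : (n * Δ) ^ 2 ≤ (t j - t i) ^ 2 := by gcongr
  nlinarith [sq_nonneg Δ]

lemma sum_pow_le_of_injOn {ι : Type*} (S : Finset ι) (d : ι → ℕ) (hd : Set.InjOn d S)
    (hpos : ∀ j ∈ S, 1 ≤ d j) {r : ℝ} (hr0 : 0 ≤ r) (hr1 : r < 1) :
    ∑ j ∈ S, r ^ d j ≤ r / (1 - r) := by
  have hs := (summable_geometric_of_lt_one hr0 hr1)
  have h1 : ∑ j ∈ S, r ^ d j = r * ∑ n ∈ S.image (fun j => d j - 1), r ^ n := by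
    rw [Finset.sum_image, Finset.mul_sum]
    · refine Finset.sum_congr rfl fun j hj => ?_
      rw [← pow_succ', Nat.sub_add_cancel (hpos j hj)]
    · intro a ha b hb hab
      have := hpos a ha
      have := hpos b hb
      exact hd ha hb (by simp only at hab; omega)
  rw [h1, div_eq_mul_inv, ← tsum_geometric_of_lt_one hr0 hr1]
  exact mul_le_mul_of_nonneg_left (hs.sum_le_tsum _ fun _ _ => by positivity) hr0

lemma sum_gaussianWindow_sub_le {k : ℕ} {t : Fin k → ℝ} {Δ σ : ℝ} (hσ : 0 < σ) (hΔ0 : 0 < Δ)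
    (ht : StrictMono t) (hΔ : ∀ i j, i ≠ j → Δ ≤ |t i - t j|) (i : Fin k) :
    ∑ j ∈ Finset.univ.erase i, gaussianWindow σ (t i - t j) ≤
      2 * Real.exp (-(Δ ^ 2 / σ ^ 2)) / (1 - Real.exp (-(Δ ^ 2 / σ ^ 2))) := by
  set r := Real.exp (-(Δ ^ 2 / σ ^ 2)) with hr
  have hr0 : 0 ≤ r := (Real.exp_pos _).le
  have hr1 : r < 1 := by
    rw [hr, Real.exp_lt_one_iff]
    have : 0 < Δ ^ 2 / σ ^ 2 := by positivity
    linarith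
  have hlow : ∑ j ∈ Finset.univ.filter (· < i), gaussianWindow σ (t i - t j) ≤ r / (1 - r) := by
    refine le_trans (Finset.sum_le_sum fun j hj => ?_)
      (sum_pow_le_of_injOn (Finset.univ.filter (· < i)) (fun j => (i : ℕ) - j) ?_ ?_ hr0 hr1)
    · simp only [Finset.mem_filter, Finset.mem_univ, true_and, Fin.lt_def] at hj
      exact gaussianWindow_sub_le_pow hσ hΔ0 ht hΔ (by omega)
    · intro a ha b hb hab
      simp only [Finset.coe_filter, Finset.mem_univ, true_and, Set.mem_ofPred_eq, Fin.lt_def] at *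
      omega
    · intro a ha
      simp only [Finset.mem_filter, Finset.mem_univ, true_and, Fin.lt_def] at ha
      omega
  have hhigh : ∑ j ∈ Finset.univ.filter (i < ·), gaussianWindow σ (t i - t j) ≤ r / (1 - r) := by
    refine le_trans (Finset.sum_le_sum fun j hj => ?_)
      (sum_pow_le_of_injOn (Finset.univ.filter (i < ·)) (fun j => (j : ℕ) - i) ?_ ?_ hr0 hr1)
    · simp only [Finset.mem_filter, Finset.mem_univ, true_and, Fin.lt_def] at hj
      rw [← gaussianWindow_neg, neg_sub]
      exact gaussianWindow_sub_le_pow hσ hΔ0 ht hΔ (by omega)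
    · intro a ha b hb hab
      simp only [Finset.coe_filter, Finset.mem_univ, true_and, Set.mem_ofPred_eq, Fin.lt_def] at *
      omega
    · intro a ha
      simp only [Finset.mem_filter, Finset.mem_univ, true_and, Fin.lt_def] at ha
      omega
  have hsplit : Finset.univ.erase i =
      Finset.univ.filter (· < i) ∪ Finset.univ.filter (i < ·) := by
    ext j
    simp [lt_or_lt_iff_ne]
  rw [hsplit, Finset.sum_union]
  · have : 2 * r / (1 - r) = r / (1 - r) + r / (1 - r) := by ring
    linarith
  · rw [Finset.disjoint_filter]
    intro j _ h1 h2
    exact lt_asymm h1 h2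

/-- Off the diagonal, the pair `(g, g')` at distance `x ≤ 1` is controlled by
`(1 + 2 / σ²) g(x)`. -/
lemma abs_gaussianWindow_add_abs_deriv_le {σ : ℝ} (hσ : 0 < σ) {x : ℝ} (hx : |x| ≤ 1) :
    |gaussianWindow σ x| + |gaussianDeriv σ x| ≤ (1 + 2 / σ ^ 2) * gaussianWindow σ x := by
  have hg := gaussianWindow_pos σ x
  rw [gaussianDeriv, abs_mul, abs_of_pos hg, abs_neg, abs_div, abs_mul, abs_two,
    abs_of_pos (pow_pos hσ 2)]
  have : 2 * |x| / σ ^ 2 ≤ 2 / σ ^ 2 := by gcongr; linarith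
  nlinarith

/-- Off the diagonal, the pair `(g', g'')` at distance `x ≤ 1`, rescaled so that the diagonal
entry `-g''(0) = 2 / σ²` becomes `1`, is controlled by the same `(1 + 2 / σ²) g(x)`. This is where
`σ ≤ √2` is used. -/
lemma abs_gaussianDeriv_add_abs_deriv2_le {σ : ℝ} (hσ : 0 < σ) (hσ2 : σ ^ 2 ≤ 2) {x : ℝ}
    (hx : |x| ≤ 1) :
    |σ ^ 2 / 2 * -gaussianDeriv2 σ x| + |σ ^ 2 / 2 * gaussianDeriv σ x| ≤
      (1 + 2 / σ ^ 2) * gaussianWindow σ x := by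
  have hg := gaussianWindow_pos σ x
  have h1 : σ ^ 2 / 2 * -gaussianDeriv2 σ x = (1 - 2 * x ^ 2 / σ ^ 2) * gaussianWindow σ x := by
    unfold gaussianDeriv2; field_simp; ring
  have h2 : σ ^ 2 / 2 * gaussianDeriv σ x = -x * gaussianWindow σ x := by
    unfold gaussianDeriv; field_simp
  rw [h1, h2, abs_mul, abs_mul, abs_of_pos hg, abs_neg, ← add_mul]
  refine mul_le_mul_of_nonneg_right ?_ hg.le
  have hx2 : x ^ 2 ≤ 1 := (sq_le_one_iff_abs_le_one x).2 hx
  have h3 : 2 * x ^ 2 / σ ^ 2 ≤ 2 / σ ^ 2 := by gcongr; linarith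
  have h3' : 0 ≤ 2 * x ^ 2 / σ ^ 2 := by positivity
  have h4 : 1 ≤ 2 / σ ^ 2 := by rw [le_div_iff₀ (by positivity)]; linarith
  have h5 : |1 - 2 * x ^ 2 / σ ^ 2| ≤ 2 / σ ^ 2 := abs_le.2 ⟨by linarith, by linarith⟩
  linarith

/-! ### Diagonal dominance of the interior system -/

/-- One row of a diagonally dominant system in the unknowns `u, v`: the coefficients `α, β` are
perturbations of `α₀, β₀`, whose entry at `u i` is `1` and whose other entries have absolute sum at
most `S`. -/
lemma abs_le_of_row_dominant {k : ℕ} {α β α₀ β₀ u v : Fin k → ℝ} {e₁ e₂ S M : ℝ} (i : Fin k)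
    (hα : ∀ j, |α j - α₀ j| ≤ e₁) (hβ : ∀ j, |β j - β₀ j| ≤ e₂) (hαi : α₀ i = 1) (hβi : β₀ i = 0)
    (hS : ∑ j ∈ Finset.univ.erase i, (|α₀ j| + |β₀ j|) ≤ S)
    (hu : ∀ j, |u j| ≤ M) (hv : ∀ j, |v j| ≤ M) :
    |u i| ≤ |∑ j, (u j * α j + v j * β j)| + (S + k * (e₁ + e₂)) * M := by
  have hM : 0 ≤ M := (abs_nonneg _).trans (hu i)
  have h1 : ∑ j, (u j * α j + v j * β j) = u i +
      ∑ j ∈ Finset.univ.erase i, (u j * α₀ j + v j * β₀ j) +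
      ∑ j, (u j * (α j - α₀ j) + v j * (β j - β₀ j)) := by
    have : u i = u i * α₀ i + v i * β₀ i := by rw [hαi, hβi]; ring
    rw [this, Finset.add_sum_erase _ (fun j => u j * α₀ j + v j * β₀ j) (Finset.mem_univ i),
      ← Finset.sum_add_distrib]
    exact Finset.sum_congr rfl fun j _ => by ring
  have h2 : |∑ j ∈ Finset.univ.erase i, (u j * α₀ j + v j * β₀ j)| ≤ S * M := by
    refine (Finset.abs_sum_le_sum_abs _ _).trans (le_trans ?_ (mul_le_mul_of_nonneg_right hS hM))
    rw [Finset.sum_mul]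
    refine Finset.sum_le_sum fun j _ => (abs_add_le _ _).trans ?_
    rw [abs_mul, abs_mul, add_mul, mul_comm |α₀ j|, mul_comm |β₀ j|]
    gcongr
    exacts [hu j, hv j]
  have h3 : |∑ j, (u j * (α j - α₀ j) + v j * (β j - β₀ j))| ≤ k * (e₁ + e₂) * M := by
    have hj : ∀ j ∈ Finset.univ, |u j * (α j - α₀ j) + v j * (β j - β₀ j)| ≤ (e₁ + e₂) * M := by
      refine fun j _ => (abs_add_le _ _).trans ?_
      rw [abs_mul, abs_mul, add_mul, mul_comm e₁, mul_comm e₂]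
      exact add_le_add (mul_le_mul (hu j) (hα j) (abs_nonneg _) hM)
        (mul_le_mul (hv j) (hβ j) (abs_nonneg _) hM)
    refine (Finset.abs_sum_le_sum_abs _ _).trans ((Finset.sum_le_sum hj).trans ?_)
    simp [mul_assoc]
  have h4 : u i = ∑ j, (u j * α j + v j * β j) -
      ∑ j ∈ Finset.univ.erase i, (u j * α₀ j + v j * β₀ j) -
      ∑ j, (u j * (α j - α₀ j) + v j * (β j - β₀ j)) := by rw [h1]; ring
  rw [abs_le] at h2 h3
  rw [h4]
  have h5 := abs_le.1 (le_refl |∑ j, (u j * α j + v j * β j)|)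
  rw [abs_le]
  constructor <;> nlinarith

/-- The interior configuration: impulses `t i` in `[0, 1]`, separated by `Δ`, and for each of them
a pair of samples `p i`, `p i + η` in `[0, 1]` near it, with `η` small in comparison with
`Fmin Δ σ`. -/
structure InteriorConfig {k : ℕ} (σ Δ η : ℝ) (t p : Fin k → ℝ) : Prop where
  σ_pos : 0 < σ
  σ_sq_le : σ ^ 2 ≤ 2
  Δ_pos : 0 < Δ
  η_pos : 0 < η
  mono : StrictMono t
  sep : ∀ i j, i ≠ j → Δ ≤ |t i - t j|
  t_mem : ∀ i, 0 ≤ t i ∧ t i ≤ 1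
  p_mem : ∀ i, 0 ≤ p i ∧ p i + η ≤ 1
  near : ∀ i, |p i - t i| ≤ η
  Fmin_pos : 0 < Fmin Δ σ
  small : k * (3 * (η * gaussianLip σ)) ≤ Fmin Δ σ / 2

/-- The row of the interior system belonging to a function `f` of the distance (the window or its
derivative) and an evaluation point `x`, in the unknowns `u i` (the sum of the coefficients of the
two samples of the `i`-th pair) and `v i` (`η` times the coefficient of the second sample). -/
noncomputable def pairRow {k : ℕ} (f : ℝ → ℝ) (η : ℝ) (p u v : Fin k → ℝ) (x : ℝ) : ℝ :=
  ∑ j, (u j * f (x - p j) + v j * ((f (x - p j - η) - f (x - p j)) / η))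

lemma InteriorConfig.dist_bounds {k : ℕ} {σ Δ η : ℝ} {t p : Fin k → ℝ}
    (C : InteriorConfig σ Δ η t p) (i j : Fin k) :
    |t i - t j| ≤ 1 ∧ |t i - p j| ≤ 1 ∧ |t i - p j - η| ≤ 1 ∧
      |t i - p j - (t i - t j)| ≤ η ∧ |t i - p j - η - (t i - t j)| ≤ 2 * η := by
  have hη := C.η_pos
  obtain ⟨a1, a2⟩ := C.t_mem i
  obtain ⟨b1, b2⟩ := C.t_mem j
  obtain ⟨c1, c2⟩ := C.p_mem j
  obtain ⟨d1, d2⟩ := abs_le.1 (C.near j)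
  refine ⟨abs_le.2 ⟨?_, ?_⟩, abs_le.2 ⟨?_, ?_⟩, abs_le.2 ⟨?_, ?_⟩, abs_le.2 ⟨?_, ?_⟩,
    abs_le.2 ⟨?_, ?_⟩⟩ <;> linarith

/-- The interior system, with its derivative rows rescaled by `σ² / 2`, is diagonally dominant with
constant at least `Fmin / 2`: for `η → 0` and `p = t` the constant is `Fmin`, and the perturbation
costs at most half of it. -/
theorem InteriorConfig.abs_unknowns_le {k : ℕ} {σ Δ η : ℝ} {t p : Fin k → ℝ}
    (C : InteriorConfig σ Δ η t p) {u v : Fin k → ℝ} {H : ℝ}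
    (h₁ : ∀ i, |pairRow (gaussianWindow σ) η p u v (t i)| ≤ H)
    (h₂ : ∀ i, σ ^ 2 / 2 * |pairRow (gaussianDeriv σ) η p u v (t i)| ≤ H) (i : Fin k) :
    |u i| ≤ 2 * H / Fmin Δ σ ∧ |v i| ≤ 2 * H / Fmin Δ σ := by
  have hσ := C.σ_pos
  have hσ2 := C.σ_sq_le
  have hη := C.η_pos
  have hF := C.Fmin_pos
  have hL : 0 ≤ gaussianLip σ := by unfold gaussianLip; positivity
  have lip0 : ∀ x y : ℝ, |x| ≤ 1 → |y| ≤ 1 →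
      |gaussianWindow σ x - gaussianWindow σ y| ≤ gaussianLip σ * |x - y| := fun x y =>
    abs_sub_le_of_hasDerivAt (hasDerivAt_gaussianWindow σ)
      (fun x hx => abs_gaussianDeriv_le hσ hσ2 hx)
  have lip1 : ∀ x y : ℝ, |x| ≤ 1 → |y| ≤ 1 →
      |gaussianDeriv σ x - gaussianDeriv σ y| ≤ gaussianLip σ * |x - y| := fun x y =>
    abs_sub_le_of_hasDerivAt hasDerivAt_gaussianDeriv
      (fun x hx => abs_gaussianDeriv2_le hσ hσ2 hx)
  have lip2 : ∀ x y : ℝ, |x| ≤ 1 → |y| ≤ 1 →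
      |gaussianDeriv2 σ x - gaussianDeriv2 σ y| ≤ gaussianLip σ * |x - y| := fun x y =>
    abs_sub_le_of_hasDerivAt hasDerivAt_gaussianDeriv2 (fun x hx => abs_gaussianDeriv3_le hσ hx)
  have hsum : ∀ i, (1 + 2 / σ ^ 2) *
      ∑ j ∈ Finset.univ.erase i, gaussianWindow σ (t i - t j) ≤ 1 - Fmin Δ σ := by
    intro i
    have := mul_le_mul_of_nonneg_left (sum_gaussianWindow_sub_le hσ C.Δ_pos C.mono C.sep i)
      (show 0 ≤ 1 + 2 / σ ^ 2 by positivity)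
    unfold Fmin
    linarith
  -- The rescaling by `σ² / 2 ≤ 1` does not increase the perturbation errors.
  have hs1 : σ ^ 2 / 2 ≤ 1 := by linarith
  have hs0 : 0 ≤ σ ^ 2 / 2 := by positivity
  have scale : ∀ x : ℝ, |σ ^ 2 / 2 * x| ≤ |x| := fun x => by
    rw [abs_mul, abs_of_nonneg hs0]
    exact mul_le_of_le_one_left (abs_nonneg x) hs1
  -- `M` is the largest of the `|u i|` and `|v i|`.
  have : Nonempty (Fin k) := ⟨i⟩
  obtain ⟨i₀, hi₀⟩ := Finite.exists_max fun i => max |u i| |v i|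
  set M := max |u i₀| |v i₀| with hM
  have hu : ∀ j, |u j| ≤ M := fun j => (le_max_left _ _).trans (hi₀ j)
  have hv : ∀ j, |v j| ≤ M := fun j => (le_max_right _ _).trans (hi₀ j)
  have hM0 : 0 ≤ M := (abs_nonneg _).trans (hu i₀)
  have hu₀ : |u i₀| ≤
      H + (1 - Fmin Δ σ + k * (gaussianLip σ * η + gaussianLip σ * (2 * η))) * M := by
    have key := abs_le_of_row_dominant (u := u) (v := v) (M := M) (S := 1 - Fmin Δ σ)
      (α := fun j => gaussianWindow σ (t i₀ - p j))
      (β := fun j => (gaussianWindow σ (t i₀ - p j - η) - gaussianWindow σ (t i₀ - p j)) / η)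
      (α₀ := fun j => gaussianWindow σ (t i₀ - t j))
      (β₀ := fun j => -gaussianDeriv σ (t i₀ - t j))
      (e₁ := gaussianLip σ * η) (e₂ := gaussianLip σ * (2 * η)) i₀ ?_ ?_ ?_ ?_ ?_ hu hv
    · have := h₁ i₀
      unfold pairRow at this
      linarith
    · intro j
      obtain ⟨b1, b2, b3, b4, b5⟩ := C.dist_bounds i₀ j
      exact (lip0 _ _ b2 b1).trans (mul_le_mul_of_nonneg_left b4 hL)
    · intro j
      obtain ⟨b1, b2, b3, b4, b5⟩ := C.dist_bounds i₀ j
      simp only [sub_neg_eq_add]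
      exact abs_diffQuot_add_deriv_le (hasDerivAt_gaussianWindow σ) lip1 hL hη b2 b3 b1
        (b4.trans (by linarith)) b5
    · simp [gaussianWindow_zero]
    · simp [gaussianDeriv]
    · refine le_trans ?_ (hsum i₀)
      rw [Finset.mul_sum]
      refine Finset.sum_le_sum fun j _ => ?_
      rw [abs_neg]
      exact abs_gaussianWindow_add_abs_deriv_le hσ (C.dist_bounds i₀ j).1
  have hv₀ : |v i₀| ≤
      H + (1 - Fmin Δ σ + k * (gaussianLip σ * (2 * η) + gaussianLip σ * η)) * M := by
    -- In the derivative rows the diagonal entry belongs to `v`, so `u` and `v` swap their roles.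
    have key := abs_le_of_row_dominant (u := v) (v := u) (M := M) (S := 1 - Fmin Δ σ)
      (β := fun j => σ ^ 2 / 2 * gaussianDeriv σ (t i₀ - p j))
      (α := fun j => σ ^ 2 / 2 *
        ((gaussianDeriv σ (t i₀ - p j - η) - gaussianDeriv σ (t i₀ - p j)) / η))
      (β₀ := fun j => σ ^ 2 / 2 * gaussianDeriv σ (t i₀ - t j))
      (α₀ := fun j => σ ^ 2 / 2 * -gaussianDeriv2 σ (t i₀ - t j))
      (e₂ := gaussianLip σ * η) (e₁ := gaussianLip σ * (2 * η)) i₀ ?_ ?_ ?_ ?_ ?_ hv hu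
    · have h := h₂ i₀
      have e : ∑ j, (v j * (σ ^ 2 / 2 *
          ((gaussianDeriv σ (t i₀ - p j - η) - gaussianDeriv σ (t i₀ - p j)) / η)) +
          u j * (σ ^ 2 / 2 * gaussianDeriv σ (t i₀ - p j))) =
          σ ^ 2 / 2 * pairRow (gaussianDeriv σ) η p u v (t i₀) := by
        unfold pairRow
        rw [Finset.mul_sum]
        exact Finset.sum_congr rfl fun j _ => by ring
      rw [e, abs_mul, abs_of_nonneg hs0] at key
      linarith
    · intro j
      obtain ⟨b1, b2, b3, b4, b5⟩ := C.dist_bounds i₀ j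
      rw [← mul_sub, sub_neg_eq_add]
      exact (scale _).trans (abs_diffQuot_add_deriv_le hasDerivAt_gaussianDeriv lip2 hL hη b2 b3 b1
        (b4.trans (by linarith)) b5)
    · intro j
      obtain ⟨b1, b2, b3, b4, b5⟩ := C.dist_bounds i₀ j
      rw [← mul_sub]
      exact (scale _).trans ((lip1 _ _ b2 b1).trans (mul_le_mul_of_nonneg_left b4 hL))
    · simp only [gaussianDeriv2, sub_self, gaussianWindow_zero]
      field_simp
      ring
    · simp [gaussianDeriv]
    · refine le_trans ?_ (hsum i₀)
      rw [Finset.mul_sum]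
      exact Finset.sum_le_sum fun j _ =>
        abs_gaussianDeriv_add_abs_deriv2_le hσ hσ2 (C.dist_bounds i₀ j).1
  have hMle : M ≤ H + (1 - Fmin Δ σ / 2) * M := by
    have := mul_le_mul_of_nonneg_right C.small hM0
    exact max_le (by linarith) (by linarith)
  have hMF : M ≤ 2 * H / Fmin Δ σ := by
    rw [le_div_iff₀ hF]
    linarith
  exact ⟨(hu i).trans hMF, (hv i).trans hMF⟩

/-! ### Certificate coefficients as solutions of linear systems -/

/-- Moving the column of `F` to the front costs the sign `(-1) ^ j`, so the minors are those of
Cramer's rule. -/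
lemma nodeMinor_succ {m : ℕ} (F g : ℝ → ℝ) (s τ : Fin m → ℝ) (j : Fin m) :
    nodeMinor F g s τ j.succ =
      (-1) ^ (j : ℕ) * Matrix.cramer (Matrix.of fun l i => g (τ l - s i)) (fun l => F (τ l)) j := by
  have h : (Matrix.of fun l i => g (τ l - s i)).updateCol j (fun l => F (τ l)) =
      ((nodeMatrix F g s τ).submatrix id j.succ.succAbove).submatrix id j.cycleRange := by
    ext l i
    simp only [Matrix.submatrix_apply, id, nodeMatrix, Matrix.of_apply, Fin.succAbove_cycleRange]
    by_cases hij : i = j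
    · subst hij
      simp
    · rw [Matrix.updateCol_ne hij, Equiv.swap_apply_of_ne_of_ne (Fin.succ_ne_zero i)
        (fun h => hij (Fin.succ_injective _ h))]
      simp
  rw [Matrix.cramer_apply, h, Matrix.det_permute', Fin.sign_cycleRange, nodeMinor, ← mul_assoc]
  simp [← mul_pow]

lemma nodeMinor_zero {m : ℕ} (F g : ℝ → ℝ) (s τ : Fin m → ℝ) :
    nodeMinor F g s τ 0 = (Matrix.of fun l i => g (τ l - s i)).det := by
  unfold nodeMinor
  congr 1

lemma certCoeff_eq_of_mulVec_eq {m : ℕ} {F g : ℝ → ℝ} {s τ x : Fin m → ℝ}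
    (hdet : (Matrix.of fun l i => g (τ l - s i)).det ≠ 0)
    (hx : (Matrix.of fun l i => g (τ l - s i)).mulVec x = fun l => F (τ l)) (j : Fin m) :
    certCoeff F g s τ j = x j := by
  unfold certCoeff
  rw [nodeMinor_succ, nodeMinor_zero, ← hx, Matrix.cramer_eq_adjugate_mulVec,
    Matrix.mulVec_mulVec, Matrix.adjugate_mul, Matrix.smul_mulVec, Matrix.one_mulVec,
    Pi.smul_apply, smul_eq_mul, mul_div_assoc, mul_div_cancel_left₀ _ hdet, ← mul_assoc, ← mul_pow]
  simp

/-! ### The pairing of the indices -/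

lemma pairFst_lt {k : ℕ} (i : Fin k) : 2 * i.val + 1 < 2 * k + 2 := by omega

lemma pairSnd_lt {k : ℕ} (i : Fin k) : 2 * i.val + 2 < 2 * k + 2 := by omega

/-- The index of the first member of the `i`-th interior pair. -/
def pairFst {k : ℕ} (i : Fin k) : Fin (2 * k + 2) := ⟨2 * i.val + 1, pairFst_lt i⟩

/-- The index of the second member of the `i`-th interior pair. -/
def pairSnd {k : ℕ} (i : Fin k) : Fin (2 * k + 2) := ⟨2 * i.val + 2, pairSnd_lt i⟩

/-- The sequence `a, c₁, d₁, …, c_k, d_k, b`. -/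
def interleave {k : ℕ} {X : Type*} (a b : X) (c d : Fin k → X) (l : Fin (2 * k + 2)) : X :=
  if h₀ : l.val = 0 then a
  else if h₁ : l.val = 2 * k + 1 then b
  else if l.val % 2 = 1 then c ⟨(l.val - 1) / 2, by omega⟩
  else d ⟨(l.val - 1) / 2, by omega⟩

section interleave

variable {k : ℕ} {X : Type*} (a b : X) (c d : Fin k → X)

@[simp] lemma interleave_zero : interleave a b c d 0 = a := by simp [interleave]

@[simp] lemma interleave_last : interleave a b c d (Fin.last (2 * k + 1)) = b := by
  simp [interleave]

@[simp] lemma interleave_pairFst (i : Fin k) : interleave a b c d (pairFst i) = c i := by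
  have h1 : i.val ≠ k := i.isLt.ne
  have h2 : (2 * i.val + 1) % 2 = 1 := by omega
  simp [interleave, pairFst, h1, h2]

@[simp] lemma interleave_pairSnd (i : Fin k) : interleave a b c d (pairSnd i) = d i := by
  have h1 : ¬ (2 * i.val + 2 = 2 * k + 1) := by omega
  have h3 : (2 * i.val + 1) / 2 = i.val := by omega
  simp [interleave, pairSnd, h1, h3]

end interleave

lemma forall_fin_pairs {k : ℕ} {p : Fin (2 * k + 2) → Prop} :
    (∀ l, p l) ↔
      p 0 ∧ p (Fin.last (2 * k + 1)) ∧ (∀ i, p (pairFst i)) ∧ ∀ i, p (pairSnd i) := by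
  refine ⟨fun h => ⟨h _, h _, fun i => h _, fun i => h _⟩, fun ⟨h0, h1, h2, h3⟩ l => ?_⟩
  by_cases e0 : l.val = 0
  · rwa [show l = 0 from Fin.ext e0]
  by_cases e1 : l.val = 2 * k + 1
  · rwa [show l = Fin.last (2 * k + 1) from Fin.ext e1]
  by_cases e2 : l.val % 2 = 1
  · rw [show l = pairFst ⟨(l.val - 1) / 2, by omega⟩ from
      Fin.ext (show l.val = 2 * ((l.val - 1) / 2) + 1 by omega)]
    exact h2 _
  · rw [show l = pairSnd ⟨(l.val - 1) / 2, by omega⟩ from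
      Fin.ext (show l.val = 2 * ((l.val - 1) / 2) + 2 by omega)]
    exact h3 _

lemma sum_range_pairs (f : ℕ → ℝ) (k : ℕ) :
    ∑ n ∈ Finset.range (2 * k + 2), f n =
      f 0 + f (2 * k + 1) + ∑ i ∈ Finset.range k, (f (2 * i + 1) + f (2 * i + 2)) := by
  induction k with
  | zero => simp [Finset.sum_range_succ]
  | succ k ih =>
    rw [show 2 * (k + 1) + 2 = 2 * k + 2 + 1 + 1 by ring, Finset.sum_range_succ,
      Finset.sum_range_succ, ih, Finset.sum_range_succ,
      show 2 * (k + 1) + 1 = 2 * k + 2 + 1 by ring]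
    ring

lemma sum_fin_pairs {k : ℕ} (f : Fin (2 * k + 2) → ℝ) :
    ∑ l, f l = f 0 + f (Fin.last (2 * k + 1)) + ∑ i, (f (pairFst i) + f (pairSnd i)) := by
  have h := sum_range_pairs (fun n => if h : n < 2 * k + 2 then f ⟨n, h⟩ else 0) k
  rw [← Fin.sum_univ_eq_sum_range, ← Fin.sum_univ_eq_sum_range
    (fun i => ((if h : 2 * i + 1 < 2 * k + 2 then f ⟨2 * i + 1, h⟩ else 0) +
      if h : 2 * i + 2 < 2 * k + 2 then f ⟨2 * i + 2, h⟩ else 0))] at h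
  simpa [pairFst_lt, pairSnd_lt, Fin.last, pairFst, pairSnd] using h

/-! ### The confluent limit -/

lemma nodes_eq_interleave {k : ℕ} (t : Fin k → ℝ) (ρ : ℝ) :
    nodes t ρ = interleave 0 1 t (fun i => t i + ρ) := rfl

/-- The matrix with rows `f(x - s_j)` at `x = 0, t_i, 1`, and with `h(i, s_j)` in the second row of
the `i`-th pair; there `h` will be a difference quotient or a derivative at `t_i`. -/
def pairMatrix {k : ℕ} (f : ℝ → ℝ) (t : Fin k → ℝ) (s : Fin (2 * k + 2) → ℝ)
    (h : Fin k → ℝ → ℝ) : Matrix (Fin (2 * k + 2)) (Fin (2 * k + 2)) ℝ :=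
  Matrix.of fun l j =>
    interleave (f (0 - s j)) (f (1 - s j)) (fun i => f (t i - s j)) (fun i => h i (s j)) l

/-- A system with rows at `t_i` and `t_i + ρ` is equivalent to the system in which the second of
these rows is replaced by the difference quotient. -/
lemma mulVec_nodes_iff {k : ℕ} {f : ℝ → ℝ} {t : Fin k → ℝ} {s x : Fin (2 * k + 2) → ℝ} {ρ : ℝ}
    (hρ : ρ ≠ 0) {a b : ℝ} {c : Fin k → ℝ} :
    (Matrix.of fun l j => f (nodes t ρ l - s j)).mulVec x = interleave a b c c ↔
      (pairMatrix f t s fun i y => (f (t i + ρ - y) - f (t i - y)) / ρ).mulVec x =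
        interleave a b c 0 := by
  simp only [funext_iff, forall_fin_pairs (k := k), Matrix.mulVec, dotProduct, pairMatrix,
    Matrix.of_apply, nodes_eq_interleave, interleave_zero, interleave_last, interleave_pairFst,
    interleave_pairSnd]
  refine and_congr_right fun _ => and_congr_right fun _ => and_congr_right fun h =>
    forall_congr' fun i => ?_
  have e : ∑ j, (f (t i + ρ - s j) - f (t i - s j)) / ρ * x j =
      (∑ j, f (t i + ρ - s j) * x j - c i) / ρ := by
    rw [← h i, ← Finset.sum_sub_distrib, Finset.sum_div]
    exact Finset.sum_congr rfl fun j _ => by ring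
  rw [e, Pi.zero_apply, div_eq_zero_iff, sub_eq_zero]
  simp [hρ]

/-- If the confluent matrix, with derivative rows, is invertible, then the limits of the
certificate coefficients exist and solve the confluent system. -/
theorem exists_isDualCertCoeff {k : ℕ} {F : ℝ → ℝ} {σ : ℝ} {t : Fin k → ℝ}
    {s : Fin (2 * k + 2) → ℝ} {c : Fin k → ℝ}
    (hdet : (pairMatrix (gaussianWindow σ) t s
      fun i y => gaussianDeriv σ (t i - y)).det ≠ 0)
    (hF : ∀ i, F (t i) = c i) (hFρ : ∀ᶠ ρ in 𝓝[>] (0 : ℝ), ∀ i, F (t i + ρ) = c i) :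
    ∃ b : EuclideanSpace ℝ (Fin (2 * k + 2)), IsDualCertCoeff F σ t s b ∧
      (pairMatrix (gaussianWindow σ) t s fun i y => gaussianDeriv σ (t i - y)).mulVec b =
        interleave (F 0) (F 1) c 0 := by
  set A := pairMatrix (gaussianWindow σ) t s fun i y => gaussianDeriv σ (t i - y) with hA
  set B : ℝ → Matrix (Fin (2 * k + 2)) (Fin (2 * k + 2)) ℝ := fun ρ =>
    pairMatrix (gaussianWindow σ) t s
      fun i y => (gaussianWindow σ (t i + ρ - y) - gaussianWindow σ (t i - y)) / ρ with hB
  set r : Fin (2 * k + 2) → ℝ := interleave (F 0) (F 1) c 0 with hr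
  have hBA : Tendsto B (𝓝[>] 0) (𝓝 A) := by
    refine tendsto_pi_nhds.2 fun l => tendsto_pi_nhds.2 fun j => ?_
    revert l
    rw [forall_fin_pairs]
    simp only [hB, hA, pairMatrix, Matrix.of_apply, interleave_zero, interleave_last,
      interleave_pairFst, interleave_pairSnd]
    refine ⟨tendsto_const_nhds, tendsto_const_nhds, fun i => tendsto_const_nhds, fun i => ?_⟩
    have h := (hasDerivAt_gaussianWindow σ (t i - s j)).tendsto_slope_zero_right
    refine h.congr fun ρ => ?_
    rw [smul_eq_mul, div_eq_inv_mul, sub_add_eq_add_sub]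
  have hdetB : Tendsto (fun ρ => (B ρ).det) (𝓝[>] 0) (𝓝 A.det) :=
    ((continuous_id.matrix_det).tendsto A).comp hBA
  have hcrB : Tendsto (fun ρ => (B ρ).cramer r) (𝓝[>] 0) (𝓝 (A.cramer r)) :=
    ((continuous_id.matrix_cramer continuous_const).tendsto A).comp hBA
  have solve : ∀ D : Matrix (Fin (2 * k + 2)) (Fin (2 * k + 2)) ℝ, D.det ≠ 0 →
      D.mulVec (D.det⁻¹ • D.cramer r) = r := by
    intro D hD
    rw [Matrix.mulVec_smul, Matrix.mulVec_cramer, smul_smul, inv_mul_cancel₀ hD, one_smul]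
  refine ⟨WithLp.toLp 2 (A.det⁻¹ • A.cramer r), fun j => ?_, solve A hdet⟩
  have hlim : Tendsto (fun ρ => (B ρ).det⁻¹ • (B ρ).cramer r) (𝓝[>] 0)
      (𝓝 (A.det⁻¹ • A.cramer r)) := (hdetB.inv₀ hdet).smul hcrB
  refine (tendsto_pi_nhds.1 hlim j).congr' ?_
  filter_upwards [hdetB.eventually_ne hdet, hFρ, self_mem_nhdsWithin] with ρ hρ hFρ hρ0
  have hρ0 : ρ ≠ 0 := ne_of_gt hρ0
  symm
  refine certCoeff_eq_of_mulVec_eq ?_ ?_ j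
  · intro h0
    obtain ⟨x, hx, hx0⟩ := Matrix.exists_mulVec_eq_zero_iff.2 h0
    have hz : (interleave 0 0 0 0 : Fin (2 * k + 2) → ℝ) = 0 := by
      rw [funext_iff, forall_fin_pairs]
      simp
    rw [← hz, mulVec_nodes_iff hρ0, hz] at hx0
    exact hρ (Matrix.exists_mulVec_eq_zero_iff.1 ⟨x, hx, hx0⟩)
  · have hc : (fun l => F (nodes t ρ l)) = interleave (F 0) (F 1) c c := by
      rw [funext_iff, forall_fin_pairs]
      simp [nodes_eq_interleave, hF, hFρ]
    rw [hc, mulVec_nodes_iff hρ0]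
    exact solve (B ρ) hρ

/-! ### Bounds for the solution of the confluent system -/

/-- Beyond the distance `σ √(log (1 / η³))` the Gaussian window is at most `η³`. -/
lemma gaussianWindow_le_pow_three {σ η x : ℝ} (hσ : 0 < σ) (hη : 0 < η)
    (hx : σ * √(Real.log (1 / η ^ 3)) ≤ x) : gaussianWindow σ x ≤ η ^ 3 := by
  have h1 : Real.log (1 / η ^ 3) ≤ x ^ 2 / σ ^ 2 := by
    rw [← div_pow]
    refine (Real.sqrt_le_left ?_).1 ?_
    · exact (Real.sqrt_nonneg _).trans ((le_div_iff₀' hσ).2 hx)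
    · exact (le_div_iff₀' hσ).2 hx
  rw [one_div, Real.log_inv] at h1
  calc gaussianWindow σ x ≤ Real.exp (Real.log (η ^ 3)) := Real.exp_le_exp.2 (by linarith)
    _ = η ^ 3 := Real.exp_log (by positivity)

/-- Passing from the coefficients `b` to the unknowns `u`, `v` of the interior system. -/
lemma sum_mul_eq_pairRow {k : ℕ} {f : ℝ → ℝ} {η : ℝ} {p : Fin k → ℝ}
    {s b : Fin (2 * k + 2) → ℝ} (hη : η ≠ 0) (hs₀ : s 0 = 0)
    (hs₁ : s (Fin.last (2 * k + 1)) = 1) (hsp : ∀ i, s (pairFst i) = p i)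
    (hsq : ∀ i, s (pairSnd i) = p i + η) (x : ℝ) :
    ∑ j, f (x - s j) * b j = f x * b 0 + f (x - 1) * b (Fin.last (2 * k + 1)) +
      pairRow f η p (fun i => b (pairFst i) + b (pairSnd i)) (fun i => η * b (pairSnd i)) x := by
  rw [sum_fin_pairs, hs₀, hs₁, sub_zero, pairRow]
  congr 1
  refine Finset.sum_congr rfl fun i _ => ?_
  rw [hsp, hsq, sub_add_eq_sub_sub]
  field_simp
  ring

/-- The interior configuration completed by the samples `0` and `1`: all interior points are so far
from `0` and `1` that the window has decayed to `η³`. -/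
structure BoundaryConfig {k : ℕ} (σ Δ η : ℝ) (t p : Fin k → ℝ)
    (s : Fin (2 * k + 2) → ℝ) : Prop extends InteriorConfig σ Δ η t p where
  s_first : s 0 = 0
  s_last : s (Fin.last (2 * k + 1)) = 1
  s_fst : ∀ i, s (pairFst i) = p i
  s_snd : ∀ i, s (pairSnd i) = p i + η
  decay_t : ∀ i, gaussianWindow σ (t i) ≤ η ^ 3 ∧ gaussianWindow σ (t i - 1) ≤ η ^ 3
  decay_p : ∀ i, gaussianWindow σ (0 - p i) ≤ η ^ 3 ∧ gaussianWindow σ (1 - p i) ≤ η ^ 3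
  decay_q : ∀ i, gaussianWindow σ (0 - p i - η) ≤ η ^ 3 ∧ gaussianWindow σ (1 - p i - η) ≤ η ^ 3
  decay_one : gaussianWindow σ 1 ≤ η ^ 3
  η_le : η ≤ Fmin Δ σ / 152
  mul_η_le : k * η ≤ Fmin Δ σ / 76

lemma Fmin_le_one {Δ σ : ℝ} : Fmin Δ σ ≤ 1 := by
  unfold Fmin
  have h : Real.exp (-(Δ ^ 2 / σ ^ 2)) ≤ 1 := by
    rw [Real.exp_le_one_iff, neg_nonpos]; positivity
  have h2 : 0 ≤ (1 + 2 / σ ^ 2) *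
      (2 * Real.exp (-(Δ ^ 2 / σ ^ 2)) / (1 - Real.exp (-(Δ ^ 2 / σ ^ 2)))) :=
    mul_nonneg (by positivity) (div_nonneg (by positivity) (by linarith))
  linarith

/-- At the end points, the interior samples contribute little. -/
lemma abs_pairRow_le {k : ℕ} {f : ℝ → ℝ} {η M e x : ℝ} {p u v : Fin k → ℝ} (hη : 0 < η)
    (hu : ∀ i, |u i| ≤ M) (hv : ∀ i, |v i| ≤ M)
    (hp : ∀ i, 0 ≤ f (x - p i) ∧ f (x - p i) ≤ e)
    (hq : ∀ i, 0 ≤ f (x - p i - η) ∧ f (x - p i - η) ≤ e) :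
    |pairRow f η p u v x| ≤ k * (e + e / η) * M := by
  have hj : ∀ j ∈ Finset.univ, |u j * f (x - p j) + v j * ((f (x - p j - η) - f (x - p j)) / η)| ≤
      (e + e / η) * M := by
    intro j _
    have hM : 0 ≤ M := (abs_nonneg _).trans (hu j)
    refine (abs_add_le _ _).trans ?_
    rw [abs_mul, abs_mul, add_mul, mul_comm e, mul_comm (e / η)]
    refine add_le_add (mul_le_mul (hu j) ?_ (abs_nonneg _) hM)
      (mul_le_mul (hv j) ?_ (abs_nonneg _) hM)
    · rw [abs_of_nonneg (hp j).1]
      exact (hp j).2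
    · rw [abs_div, abs_of_pos hη]
      gcongr
      rw [abs_le]
      constructor <;> linarith [(hp j).1, (hp j).2, (hq j).1, (hq j).2]
  refine (Finset.abs_sum_le_sum_abs _ _).trans ((Finset.sum_le_sum hj).trans ?_)
  simp [mul_assoc]

/-- The solution of the confluent system: the boundary coefficients and the interior unknowns
`b (pairFst i) + b (pairSnd i)`, `η * b (pairSnd i)` are bounded by the right-hand side, and the
boundary values enter the interior bound only with a factor `η³`. -/
theorem BoundaryConfig.abs_unknowns_le {k : ℕ} {σ Δ η : ℝ} {t p : Fin k → ℝ}
    {s : Fin (2 * k + 2) → ℝ}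
    (C : BoundaryConfig σ Δ η t p s) {b : Fin (2 * k + 2) → ℝ} {a₀ a₁ A H : ℝ} {c : Fin k → ℝ}
    (hb : (pairMatrix (gaussianWindow σ) t s fun i y => gaussianDeriv σ (t i - y)).mulVec b =
      interleave a₀ a₁ c 0)
    (ha₀ : |a₀| ≤ A) (ha₁ : |a₁| ≤ A) (hH : 0 ≤ H) (hc : ∀ i, |c i| ≤ H) :
    |b 0| ≤ 2 * A + H ∧ |b (Fin.last (2 * k + 1))| ≤ 2 * A + H ∧
    ∀ i, |b (pairFst i) + b (pairSnd i)| ≤ 2 * (H + 2 * η ^ 3 * (2 * A + H)) / Fmin Δ σ ∧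
      |η * b (pairSnd i)| ≤ 2 * (H + 2 * η ^ 3 * (2 * A + H)) / Fmin Δ σ := by
  have hη := C.η_pos
  have hσ := C.σ_pos
  have hF := C.Fmin_pos
  have row := fun (f : ℝ → ℝ) (x : ℝ) => sum_mul_eq_pairRow (f := f) (b := b) hη.ne' C.s_first
    C.s_last C.s_fst C.s_snd x
  simp only [funext_iff, forall_fin_pairs (k := k), Matrix.mulVec, dotProduct, pairMatrix,
    Matrix.of_apply, interleave_zero, interleave_last, interleave_pairFst,
    interleave_pairSnd, row, Pi.zero_apply] at hb
  obtain ⟨hb0, hb1, hb2, hb3⟩ := hb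
  set u : Fin k → ℝ := fun i => b (pairFst i) + b (pairSnd i) with hu
  set v : Fin k → ℝ := fun i => η * b (pairSnd i) with hv
  set b₀ := b 0
  set b₁ := b (Fin.last (2 * k + 1))
  set B := max |b₀| |b₁| with hB
  have hB0 : |b₀| ≤ B := le_max_left _ _
  have hB1 : |b₁| ≤ B := le_max_right _ _
  have hBnn : 0 ≤ B := (abs_nonneg _).trans hB0
  have end_le : ∀ {x y : ℝ}, |x| ≤ η ^ 3 → |y| ≤ η ^ 3 → |x * b₀ + y * b₁| ≤ 2 * η ^ 3 * B := by
    intro x y hx hy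
    refine (abs_add_le _ _).trans ?_
    rw [abs_mul, abs_mul]
    have h1 := mul_le_mul hx hB0 (abs_nonneg _) (by positivity)
    have h2 := mul_le_mul hy hB1 (abs_nonneg _) (by positivity)
    linarith
  have habs : ∀ {x : ℝ}, gaussianWindow σ x ≤ η ^ 3 → |gaussianWindow σ x| ≤ η ^ 3 :=
    fun h => by rwa [abs_of_pos (gaussianWindow_pos _ _)]
  have hint := C.toInteriorConfig.abs_unknowns_le (u := u) (v := v) (H := H + 2 * η ^ 3 * B)
    (fun i => by
      rw [show pairRow (gaussianWindow σ) η p u v (t i) = c i -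
        (gaussianWindow σ (t i) * b₀ + gaussianWindow σ (t i - 1) * b₁) by linarith [hb2 i]]
      exact (abs_sub _ _).trans
        (add_le_add (hc i) (end_le (habs (C.decay_t i).1) (habs (C.decay_t i).2))))
    (fun i => by
      have hs : 0 ≤ σ ^ 2 / 2 := by positivity
      have hd : ∀ x : ℝ, |x| ≤ 1 → gaussianWindow σ x ≤ η ^ 3 →
          |σ ^ 2 / 2 * gaussianDeriv σ x| ≤ η ^ 3 := by
        intro x hx hg
        have : σ ^ 2 / 2 * gaussianDeriv σ x = -x * gaussianWindow σ x := by
          unfold gaussianDeriv; field_simp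
        rw [this, abs_mul, abs_neg]
        exact (mul_le_of_le_one_left (abs_nonneg _) hx).trans (habs hg)
      have he : σ ^ 2 / 2 * |pairRow (gaussianDeriv σ) η p u v (t i)| =
          |σ ^ 2 / 2 * pairRow (gaussianDeriv σ) η p u v (t i)| := by
        rw [abs_mul, abs_of_nonneg hs]
      rw [he, show σ ^ 2 / 2 * pairRow (gaussianDeriv σ) η p u v (t i) =
        -(σ ^ 2 / 2 * gaussianDeriv σ (t i) * b₀ + σ ^ 2 / 2 * gaussianDeriv σ (t i - 1) * b₁) by
          linear_combination (σ ^ 2 / 2) * hb3 i, abs_neg]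
      obtain ⟨ht0, ht1⟩ := C.t_mem i
      have := end_le (hd (t i) (abs_le.2 ⟨by linarith, by linarith⟩) (C.decay_t i).1)
        (hd (t i - 1) (abs_le.2 ⟨by linarith, by linarith⟩) (C.decay_t i).2)
      linarith)
  set M := 2 * (H + 2 * η ^ 3 * B) / Fmin Δ σ with hM
  have hMF : Fmin Δ σ * M = 2 * (H + 2 * η ^ 3 * B) := by rw [hM]; field_simp
  have hMnn : 0 ≤ M := by positivity
  have hη1 : η ≤ 1 / 152 := by linarith [C.η_le, Fmin_le_one (Δ := Δ) (σ := σ)]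
  have hη3 : η ^ 3 ≤ 1 / 100 := by
    calc η ^ 3 ≤ (1 / 152) ^ 3 := by gcongr
      _ ≤ 1 / 100 := by norm_num
  -- Dividing by `η` costs one power of `η`; one further power absorbs `k / Fmin`.
  have hpair : k * (η ^ 3 + η ^ 3 / η) * M ≤ 1 / 100 * H + 1 / 100 * B := by
    have e1 : k * (η ^ 3 + η ^ 3 / η) * M = (η + 1) * η * (k * η * M) := by
      field_simp
    have e2 : k * η * M ≤ Fmin Δ σ / 76 * M := mul_le_mul_of_nonneg_right C.mul_η_le hMnn
    have e3 : (η + 1) * η ≤ 1 / 10 := by nlinarith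
    have e4 : 0 ≤ k * η * M := by positivity
    have e5 : η ^ 3 * B ≤ 1 / 100 * B := mul_le_mul_of_nonneg_right hη3 hBnn
    rw [e1]
    nlinarith
  have hη3B : η ^ 3 * B ≤ 1 / 100 * B := mul_le_mul_of_nonneg_right hη3 hBnn
  have hone : |gaussianWindow σ (0 - 1)| ≤ η ^ 3 := by
    rw [zero_sub, gaussianWindow_neg]
    exact habs C.decay_one
  have hb₀ : |b₀| ≤ A + η ^ 3 * B + k * (η ^ 3 + η ^ 3 / η) * M := by
    have h := abs_pairRow_le (f := gaussianWindow σ) (x := 0) hη (fun i => (hint i).1)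
      (fun i => (hint i).2) (fun i => ⟨(gaussianWindow_pos _ _).le, (C.decay_p i).1⟩)
      (fun i => ⟨(gaussianWindow_pos _ _).le, (C.decay_q i).1⟩)
    rw [gaussianWindow_zero] at hb0
    rw [show b₀ = a₀ - gaussianWindow σ (0 - 1) * b₁ - pairRow (gaussianWindow σ) η p u v 0 by
      linarith]
    refine (abs_sub _ _).trans (add_le_add ((abs_sub _ _).trans (add_le_add ha₀ ?_)) h)
    rw [abs_mul]
    exact mul_le_mul hone hB1 (abs_nonneg _) (by positivity)
  have hb₁ : |b₁| ≤ A + η ^ 3 * B + k * (η ^ 3 + η ^ 3 / η) * M := by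
    have h := abs_pairRow_le (f := gaussianWindow σ) (x := 1) hη (fun i => (hint i).1)
      (fun i => (hint i).2) (fun i => ⟨(gaussianWindow_pos _ _).le, (C.decay_p i).2⟩)
      (fun i => ⟨(gaussianWindow_pos _ _).le, (C.decay_q i).2⟩)
    rw [sub_self, gaussianWindow_zero] at hb1
    rw [show b₁ = a₁ - gaussianWindow σ 1 * b₀ - pairRow (gaussianWindow σ) η p u v 1 by
      linarith]
    refine (abs_sub _ _).trans (add_le_add ((abs_sub _ _).trans (add_le_add ha₁ ?_)) h)
    rw [abs_mul]
    exact mul_le_mul (habs C.decay_one) hB0 (abs_nonneg _) (by positivity)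
  have hA : 0 ≤ A := (abs_nonneg _).trans ha₀
  have hBle : B ≤ 2 * A + H := by
    have : B ≤ A + η ^ 3 * B + k * (η ^ 3 + η ^ 3 / η) * M := max_le hb₀ hb₁
    linarith
  have hMle : M ≤ 2 * (H + 2 * η ^ 3 * (2 * A + H)) / Fmin Δ σ := by
    rw [hM]; gcongr
  exact ⟨hB0.trans hBle, hB1.trans hBle,
    fun i => ⟨(hint i).1.trans hMle, (hint i).2.trans hMle⟩⟩

/-- The confluent matrix is invertible. -/
theorem BoundaryConfig.det_ne_zero {k : ℕ} {σ Δ η : ℝ} {t p : Fin k → ℝ}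
    {s : Fin (2 * k + 2) → ℝ} (C : BoundaryConfig σ Δ η t p s) :
    (pairMatrix (gaussianWindow σ) t s fun i y => gaussianDeriv σ (t i - y)).det ≠ 0 := by
  intro h0
  obtain ⟨b, hb, hb0⟩ := Matrix.exists_mulVec_eq_zero_iff.2 h0
  have hz : (interleave 0 0 0 0 : Fin (2 * k + 2) → ℝ) = 0 := by
    rw [funext_iff, forall_fin_pairs]
    simp
  rw [← hz] at hb0
  obtain ⟨h1, h2, h3⟩ := C.abs_unknowns_le hb0 (A := 0) (H := 0) (by simp) (by simp) le_rfl
    (by simp)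
  simp only [mul_zero, add_zero, zero_div, abs_nonpos_iff, mul_eq_zero, C.η_pos.ne',
    false_or] at h1 h2 h3
  refine hb (funext_iff.2 (forall_fin_pairs.2 ⟨h1, h2, fun i => ?_, fun i => (h3 i).2⟩))
  have := (h3 i).1
  rwa [(h3 i).2, add_zero] at this

/-- With vanishing interior data, the coefficients are bounded by the boundary data, uniformly in
`η`: the factor `η³` absorbs the division by `η`. -/
theorem BoundaryConfig.abs_le_of_interior_eq_zero {k : ℕ} {σ Δ η : ℝ} {t p : Fin k → ℝ}
    {s : Fin (2 * k + 2) → ℝ} (C : BoundaryConfig σ Δ η t p s) {b : Fin (2 * k + 2) → ℝ}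
    {a₀ a₁ A : ℝ}
    (hb : (pairMatrix (gaussianWindow σ) t s fun i y => gaussianDeriv σ (t i - y)).mulVec b =
      interleave a₀ a₁ 0 0)
    (ha₀ : |a₀| ≤ A) (ha₁ : |a₁| ≤ A) (j : Fin (2 * k + 2)) : |b j| ≤ 2 * A := by
  obtain ⟨h1, h2, h3⟩ := C.abs_unknowns_le hb ha₀ ha₁ le_rfl (by simp)
  have hη := C.η_pos
  have hF := C.Fmin_pos
  have hA : 0 ≤ A := (abs_nonneg _).trans ha₀
  have hη1 : η ≤ 1 / 152 := by linarith [C.η_le, Fmin_le_one (Δ := Δ) (σ := σ)]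
  have hsmall : 2 * (0 + 2 * η ^ 3 * (2 * A + 0)) / Fmin Δ σ ≤ η * (A / 2) := by
    rw [div_le_iff₀ hF]
    have e1 : η * η ≤ Fmin Δ σ / 152 :=
      (mul_le_of_le_one_right hη.le (by linarith)).trans C.η_le
    have e2 := mul_le_mul_of_nonneg_right e1 (mul_nonneg hη.le hA)
    have e3 : 0 ≤ Fmin Δ σ * (η * A) := by positivity
    nlinarith
  have hsnd : ∀ i, |b (pairSnd i)| ≤ A / 2 := fun i => by
    have h := (h3 i).2.trans hsmall
    rw [abs_mul, abs_of_pos hη] at h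
    exact le_of_mul_le_mul_left h hη
  revert j
  rw [forall_fin_pairs]
  refine ⟨by linarith, by linarith, fun i => ?_, fun i => (hsnd i).trans (by linarith)⟩
  have e : η * (A / 2) ≤ A / 2 := mul_le_of_le_one_left (by linarith) (by linarith)
  have h4 := (h3 i).1.trans (hsmall.trans e)
  have h5 : b (pairFst i) = (b (pairFst i) + b (pairSnd i)) - b (pairSnd i) := by ring
  rw [h5]
  exact (abs_sub _ _).trans (by linarith [hsnd i])

/-- With interior values of modulus at most `1`, the coefficients are `O(1 / (η Fmin))`. -/
theorem BoundaryConfig.abs_le_of_interior_le_one {k : ℕ} {σ Δ η : ℝ} {t p : Fin k → ℝ}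
    {s : Fin (2 * k + 2) → ℝ} (C : BoundaryConfig σ Δ η t p s) {b : Fin (2 * k + 2) → ℝ}
    {a₀ a₁ A : ℝ} {c : Fin k → ℝ}
    (hb : (pairMatrix (gaussianWindow σ) t s fun i y => gaussianDeriv σ (t i - y)).mulVec b =
      interleave a₀ a₁ c 0)
    (ha₀ : |a₀| ≤ A) (ha₁ : |a₁| ≤ A) (hc : ∀ i, |c i| ≤ 1) (j : Fin (2 * k + 2)) :
    |b j| ≤ 4 * (2 + A) / (η * Fmin Δ σ) := by
  obtain ⟨h1, h2, h3⟩ := C.abs_unknowns_le hb ha₀ ha₁ zero_le_one hc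
  have hη := C.η_pos
  have hF := C.Fmin_pos
  have hF1 := Fmin_le_one (Δ := Δ) (σ := σ)
  have hA : 0 ≤ A := (abs_nonneg _).trans ha₀
  have hη1 : η ≤ 1 / 152 := by linarith [C.η_le]
  have hη3 : η ^ 3 ≤ 1 / 4 := by
    calc η ^ 3 ≤ (1 / 152) ^ 3 := by gcongr
      _ ≤ 1 / 4 := by norm_num
  have hM : 2 * (1 + 2 * η ^ 3 * (2 * A + 1)) / Fmin Δ σ ≤ 2 * (2 + A) / Fmin Δ σ := by
    refine div_le_div_of_nonneg_right ?_ hF.le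
    nlinarith
  set N := 2 * (2 + A) / Fmin Δ σ with hN
  have hN2 : 2 * (2 + A) ≤ N := by
    rw [hN, le_div_iff₀ hF]
    exact mul_le_of_le_one_right (by positivity) hF1
  have hgoal : 4 * (2 + A) / (η * Fmin Δ σ) = 2 * (N / η) := by
    rw [hN]; field_simp; norm_num
  have hNη : N ≤ N / η := by
    rw [le_div_iff₀ hη]
    exact mul_le_of_le_one_right (by linarith) (by linarith)
  have hsnd : ∀ i, |b (pairSnd i)| ≤ N / η := fun i => by
    have h := (h3 i).2.trans hM
    rw [abs_mul, abs_of_pos hη] at h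
    rwa [le_div_iff₀' hη]
  rw [hgoal]
  revert j
  rw [forall_fin_pairs]
  refine ⟨by linarith, by linarith, fun i => ?_, fun i => (hsnd i).trans (by linarith)⟩
  have h4 := (h3 i).1.trans hM
  have h5 : b (pairFst i) = (b (pairFst i) + b (pairSnd i)) - b (pairSnd i) := by ring
  rw [h5]
  exact (abs_sub _ _).trans (by linarith [hsnd i])

lemma norm_le_sqrt_mul_of_abs_le {n : ℕ} {b : EuclideanSpace ℝ (Fin n)} {c : ℝ} (hc : 0 ≤ c)
    (h : ∀ j, |b j| ≤ c) : ‖b‖ ≤ √n * c := by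
  rw [EuclideanSpace.norm_eq, ← Real.sqrt_sq hc, ← Real.sqrt_mul (Nat.cast_nonneg n)]
  apply Real.sqrt_le_sqrt
  refine (Finset.sum_le_sum (g := fun _ => c ^ 2) fun j _ => ?_).trans (by simp)
  exact pow_le_pow_left₀ (norm_nonneg _) (h j) 2

/-! ### The values of the target functions at the nodes -/

lemma targetF_of_near {k : ℕ} {t : Fin k → ℝ} {ε f₀ f₁ fbar x : ℝ} (h0 : x ≠ 0) (h1 : x ≠ 1)
    {i : Fin k} (hi : |x - t i| ≤ ε) : targetF t ε f₀ f₁ fbar x = 0 := by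
  rw [targetF, if_neg h0, if_neg h1, if_pos ⟨i, hi⟩]

/-- Within distance `Δ - ε` of an impulse the choice of a sign is unambiguous. -/
lemma targetFSign_of_near {k : ℕ} {t π : Fin k → ℝ} {ε f₀ f₁ fbar Δ x : ℝ}
    (hΔ : ∀ i j, i ≠ j → Δ ≤ |t i - t j|) (h0 : x ≠ 0) (h1 : x ≠ 1)
    {i : Fin k} (hi : |x - t i| ≤ ε) (hiΔ : |x - t i| < Δ - ε) :
    targetFSign t π ε f₀ f₁ fbar x = π i := by
  have h : ∃ i, |x - t i| ≤ ε := ⟨i, hi⟩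
  rw [targetFSign, if_neg h0, if_neg h1, dif_pos h]
  congr 1
  by_contra hne
  have h2 := hΔ _ _ hne
  have h3 := h.choose_spec
  have h4 := abs_sub_le (t h.choose) x (t i)
  rw [abs_sub_comm (t h.choose) x] at h4
  linarith

lemma eventually_nodes_near {k : ℕ} {t : Fin k → ℝ} (ht : ∀ i, 0 < t i ∧ t i < 1) {δ : ℝ}
    (hδ : 0 < δ) :
    ∀ᶠ ρ in 𝓝[>] (0 : ℝ), ∀ i, t i + ρ ≠ 0 ∧ t i + ρ ≠ 1 ∧ |t i + ρ - t i| < δ := by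
  rw [eventually_all]
  intro i
  have h1 : (0 : ℝ) < min δ (1 - t i) := lt_min hδ (by linarith [(ht i).2])
  filter_upwards [Ioo_mem_nhdsGT h1] with ρ hρ
  have h2 := hρ.2.trans_le (min_le_left _ _)
  have h3 := hρ.2.trans_le (min_le_right _ _)
  refine ⟨by linarith [hρ.1, (ht i).1], by linarith, ?_⟩
  rw [add_sub_cancel_left, abs_of_pos hρ.1]
  exact h2

/-! ### The constants -/

lemma exp_neg_lt_of_separation {σ Δ : ℝ} (hσ : 0 < σ)
    (hΔσ : σ * √(Real.log (3 + 4 / σ ^ 2)) < Δ) :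
    Real.exp (-(Δ ^ 2 / σ ^ 2)) * (3 + 4 / σ ^ 2) < 1 := by
  have hpos : 0 < 3 + 4 / σ ^ 2 := by positivity
  have h1 : Real.log (3 + 4 / σ ^ 2) < Δ ^ 2 / σ ^ 2 := by
    rw [← div_pow]
    exact Real.lt_sq_of_sqrt_lt ((lt_div_iff₀' hσ).2 hΔσ)
  have h2 := (Real.log_lt_iff_lt_exp hpos).1 h1
  rw [Real.exp_neg]
  exact (inv_mul_lt_one₀ (Real.exp_pos _)).2 h2

/-- The separation condition on `Δ` says that `Fmin` is positive. -/
lemma Fmin_pos_of_separation {σ Δ : ℝ} (hσ : 0 < σ)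
    (hΔσ : σ * √(Real.log (3 + 4 / σ ^ 2)) < Δ) : 0 < Fmin Δ σ := by
  have h := exp_neg_lt_of_separation hσ hΔσ
  unfold Fmin
  set r := Real.exp (-(Δ ^ 2 / σ ^ 2))
  have hr : 0 < r := Real.exp_pos _
  have h4 : 0 < r * (4 / σ ^ 2) := by positivity
  have hr1 : 0 < 1 - r := by linarith
  rw [sub_pos, ← mul_div_assoc, div_lt_one hr1]
  have : 4 / σ ^ 2 = 2 * (2 / σ ^ 2) := by ring
  rw [this] at h
  linarith

lemma one_le_Fmax {σ Δ : ℝ} : 1 ≤ Fmax Δ σ := by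
  have h : Real.exp (-(Δ ^ 2 / σ ^ 2)) ≤ 1 := by
    rw [Real.exp_le_one_iff, neg_nonpos]; positivity
  have h1 : 0 ≤ 1 - Real.exp (-(Δ ^ 2 / σ ^ 2)) := by linarith
  refine one_le_mul_of_one_le_of_one_le ?_ ?_ <;> rw [Real.one_le_sqrt]
  · have : 0 ≤ (1 + 4 / σ ^ 4) * (2 / (1 - Real.exp (-(Δ ^ 2 / σ ^ 2)))) := by positivity
    linarith
  · have : 0 ≤ (1 / σ ^ 4 + 2 / σ ^ 6 + 2 / σ ^ 8) *
      (24 / (1 - Real.exp (-(Δ ^ 2 / σ ^ 2)))) := by positivity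
    linarith

lemma one_div_Fmin_le_Fratio_pow {σ Δ : ℝ} (hF : 0 < Fmin Δ σ) {k : ℕ} (hk : 1 ≤ k) :
    1 / Fmin Δ σ ≤ Fratio Δ σ ^ k := by
  have hF1 := Fmin_le_one (Δ := Δ) (σ := σ)
  have h1 : 1 / Fmin Δ σ ≤ Fratio Δ σ := by
    unfold Fratio
    rw [div_le_div_iff₀ hF (by positivity)]
    nlinarith [one_le_Fmax (Δ := Δ) (σ := σ), mul_nonneg hF.le (sub_nonneg.2 hF1)]
  have h2 : 1 ≤ 1 / Fmin Δ σ := by rwa [le_div_iff₀ hF, one_mul]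
  exact h1.trans (le_self_pow₀ (h2.trans h1) (by omega))

/-- The smallness condition on `η` controls both the perturbation of the interior system, through
the Lipschitz constant, and the size of `η` itself. -/
lemma eta_bounds {k : ℕ} (hk : 1 ≤ k) {σ Δ η : ℝ} (hσ : 0 < σ) (hη : 0 < η) (hΔ : 0 < Δ)
    (hη₂ : η ≤ 8 * Fmin Δ σ / (34 * (2 * k + 2) *
      √(80 * k + 8 + k * Ppoly σ * (3 / (1 - Real.exp (-(Δ ^ 2 / σ ^ 2))))))) :
    k * (3 * (η * gaussianLip σ)) ≤ Fmin Δ σ / 2 ∧ η * (2 * k + 2) ≤ Fmin Δ σ / 38 := by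
  set r := Real.exp (-(Δ ^ 2 / σ ^ 2)) with hr
  have hr0 : 0 < r := Real.exp_pos _
  have hr1 : r < 1 := by
    rw [hr, Real.exp_lt_one_iff, neg_lt_zero]; positivity
  set Q := √(80 * k + 8 + k * Ppoly σ * (3 / (1 - r))) with hQ
  have hk' : (1 : ℝ) ≤ k := by exact_mod_cast hk
  have hL : 0 < gaussianLip σ := by unfold gaussianLip; positivity
  have hP : 9 / 4 * gaussianLip σ ^ 2 ≤ Ppoly σ := by
    unfold Ppoly gaussianLip
    have : 0 ≤ 4 / σ ^ 4 + 13 / 4 * (2 / σ ^ 2 + 4 / σ ^ 4) ^ 2 := by positivity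
    linarith
  have h3 : 3 ≤ 3 / (1 - r) := by
    rw [le_div_iff₀ (by linarith)]; linarith
  have hP0 : 0 ≤ Ppoly σ := le_trans (by positivity) hP
  -- `Ppoly` contains the square of the Lipschitz constant, so the square root is at least `2 L`.
  have h4 : 3 * Ppoly σ ≤ k * Ppoly σ * (3 / (1 - r)) := by
    have h5 : Ppoly σ ≤ k * Ppoly σ := le_mul_of_one_le_left hP0 hk'
    nlinarith
  have hQ9 : 9 ≤ Q := Real.le_sqrt_of_sq_le (by nlinarith)
  have hQL : 2 * gaussianLip σ ≤ Q := Real.le_sqrt_of_sq_le (by nlinarith)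
  have hQ0 : 0 < Q := by linarith
  rw [le_div_iff₀ (by positivity)] at hη₂
  have hηk : 0 < η * (2 * k + 2) := by positivity
  constructor
  · have := mul_le_mul_of_nonneg_left hQL hηk.le
    have : 0 < η * gaussianLip σ := by positivity
    nlinarith
  · nlinarith [mul_le_mul_of_nonneg_left hQ9 hηk.le]

lemma le_one_div_one_sub_sqrt_exp : 4 ≤ 1 / (1 - √(Real.exp 1) / 2) := by
  have h1 := Real.exp_one_gt_d9
  have h2 := Real.exp_one_lt_d9
  have h3 : 3 / 2 ≤ √(Real.exp 1) := Real.le_sqrt_of_sq_le (by norm_num; linarith)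
  have h4 : √(Real.exp 1) < 2 := by
    rw [Real.sqrt_lt' two_pos]; linarith
  rw [le_div_iff₀ (by linarith)]
  linarith

end SuperRes

theorem mainTheorem7 (k : ℕ) (hk : 1 ≤ k) (σ Δ η ε f₀ f₁ fbar : ℝ)
    (t : Fin k → ℝ) (s : Fin (2 * k + 2) → ℝ)
    -- the positive parameters
    (hσ : 0 < σ) (hη : 0 < η) (hε : 0 < ε) (hf₀ : 0 < f₀) (hf₁ : 0 < f₁) (hfbar : 0 < fbar)
    -- impulses: increasing, separated by at least `Δ`, with `ε ≤ Δ / 2`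
    (ht : StrictMono t) (hΔ : ∀ i j, i ≠ j → Δ ≤ |t i - t j|) (hεΔ : ε ≤ Δ / 2)
    -- samples: the two end points, and two samples near each impulse
    (hs_first : s 0 = 0) (hs_last : s (Fin.last (2 * k + 1)) = 1)
    (hs_near : ∀ i : Fin k, |s ⟨2 * i.val + 1, by omega⟩ - t i| ≤ η)
    (hs_gap : ∀ i : Fin k, s ⟨2 * i.val + 2, by omega⟩ - s ⟨2 * i.val + 1, by omega⟩ = η)
    -- impulses and interior samples are away from the boundary of `[0,1]`
    (ht_bdry : ∀ i, σ * √(Real.log (1 / η ^ 3)) ≤ t i ∧ t i ≤ 1 - σ * √(Real.log (1 / η ^ 3)))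
    (hs_bdry : ∀ j : Fin (2 * k + 2), j ≠ 0 → j ≠ Fin.last (2 * k + 1) →
      σ * √(Real.log (1 / η ^ 3)) ≤ s j ∧ s j ≤ 1 - σ * √(Real.log (1 / η ^ 3)))
    -- conditions on the width, the separation and `η`
    (hσ_le : σ ≤ √2) (hΔσ : σ * √(Real.log (3 + 4 / σ ^ 2)) < Δ) (hησ : η ≤ σ ^ 2)
    (hη₁ : η ^ 3 * (4 * k + 4 + 4 * k / σ ^ 2) ≤ √(SuperRes.Cbar f₀ f₁))
    (hη₂ : η ≤ 8 * SuperRes.Fmin Δ σ /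
      (34 * (2 * k + 2) *
        √(80 * k + 8 + k * SuperRes.Ppoly σ * (3 / (1 - Real.exp (-(Δ ^ 2 / σ ^ 2))))))) :
    (∃ b : EuclideanSpace ℝ (Fin (2 * k + 2)),
      SuperRes.IsDualCertCoeff (SuperRes.targetF t ε f₀ f₁ fbar) σ t s b ∧
      ‖b‖ ≤ √((2 * k + 2) * (4 * k + 5 + 4 * k / σ ^ 4)) / (1 - √(Real.exp 1) / 2) *
        SuperRes.Cbar f₀ f₁ ^ (5 / 4 : ℝ) * SuperRes.Fratio Δ σ ^ k) ∧
    (∀ π : Fin k → ℝ, (∀ i, π i = 1 ∨ π i = -1) →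
      ∃ bπ : EuclideanSpace ℝ (Fin (2 * k + 2)),
        SuperRes.IsDualCertCoeff (SuperRes.targetFSign t π ε f₀ f₁ fbar) σ t s bπ ∧
        ‖bπ‖ ≤ √(2 * k + 2) / (η * (1 - √(Real.exp 1) / 2)) *
          (SuperRes.Cbar f₀ f₁ + 2 * k) ^ (3 / 2 : ℝ) * SuperRes.Fratio Δ σ ^ k) := by
  open SuperRes in
  have hΔ0 : 0 < Δ := lt_of_le_of_lt (by positivity) hΔσ
  have hF := Fmin_pos_of_separation hσ hΔσ
  have hF1 := Fmin_le_one (Δ := Δ) (σ := σ)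
  obtain ⟨hsmall, hηk⟩ := eta_bounds hk hσ hη hΔ0 hη₂
  have hk' : (1 : ℝ) ≤ k := by exact_mod_cast hk
  have hη152 : η ≤ Fmin Δ σ / 152 := by nlinarith
  have hlog : 0 < Real.log (1 / η ^ 3) := by
    refine Real.log_pos ((one_lt_div (by positivity)).2 (pow_lt_one₀ hη.le ?_ three_ne_zero))
    linarith
  set w := σ * √(Real.log (1 / η ^ 3)) with hw
  have hw0 : 0 < w := mul_pos hσ (Real.sqrt_pos.2 hlog)
  have decay : ∀ {x : ℝ}, w ≤ x → gaussianWindow σ x ≤ η ^ 3 := fun h =>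
    gaussianWindow_le_pow_three hσ hη h
  have decay' : ∀ {x : ℝ}, w ≤ -x → gaussianWindow σ x ≤ η ^ 3 := fun h => by
    rw [← gaussianWindow_neg]
    exact decay h
  set p : Fin k → ℝ := fun i => s (pairFst i) with hp
  have hq : ∀ i, s (pairSnd i) = p i + η := fun i => by
    have := hs_gap i
    simp only [hp, pairFst, pairSnd]
    linarith
  have hpb : ∀ i, w ≤ p i ∧ p i ≤ 1 - w := fun i =>
    hs_bdry _ (Fin.ne_of_val_ne (Nat.succ_ne_zero _)) (Fin.ne_of_val_ne (by simp [pairFst]; omega))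
  have hqb : ∀ i, w ≤ p i + η ∧ p i + η ≤ 1 - w := fun i => by
    rw [← hq]
    exact hs_bdry _ (Fin.ne_of_val_ne (Nat.succ_ne_zero _))
      (Fin.ne_of_val_ne (by simp [pairSnd]; omega))
  have htb : ∀ i, 0 < t i ∧ t i < 1 := fun i =>
    ⟨by linarith [(ht_bdry i).1], by linarith [(ht_bdry i).2]⟩
  have C : BoundaryConfig σ Δ η t p s :=
    { σ_pos := hσ
      σ_sq_le := by
        calc σ ^ 2 ≤ √2 ^ 2 := by gcongr
          _ = 2 := Real.sq_sqrt two_pos.le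
      Δ_pos := hΔ0
      η_pos := hη
      mono := ht
      sep := hΔ
      t_mem := fun i => ⟨(htb i).1.le, (htb i).2.le⟩
      p_mem := fun i => ⟨by linarith [(hpb i).1], by linarith [(hqb i).2]⟩
      near := hs_near
      Fmin_pos := hF
      small := hsmall
      s_first := hs_first
      s_last := hs_last
      s_fst := fun i => rfl
      s_snd := hq
      decay_t := fun i => ⟨decay (ht_bdry i).1, decay' (by linarith [(ht_bdry i).2])⟩
      decay_p := fun i => ⟨decay' (by linarith [(hpb i).1]), decay (by linarith [(hpb i).2])⟩
      decay_q := fun i => ⟨decay' (by linarith [(hqb i).1]), decay (by linarith [(hqb i).2])⟩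
      decay_one := decay (by linarith [(ht_bdry ⟨0, hk⟩).1, (ht_bdry ⟨0, hk⟩).2])
      η_le := hη152
      mul_η_le := by linarith }
  have hFr := one_div_Fmin_le_Fratio_pow hF hk
  have hFr1 : 1 ≤ Fratio Δ σ ^ k := le_trans (by rwa [le_div_iff₀ hF, one_mul]) hFr
  obtain ⟨E, hE, hE4⟩ : ∃ E : ℝ, 1 / (1 - √(Real.exp 1) / 2) = E ∧ 4 ≤ E :=
    ⟨_, rfl, le_one_div_one_sub_sqrt_exp⟩
  have hC : (f₀ + f₁) + 2 ≤ Cbar f₀ f₁ := by unfold Cbar; nlinarith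
  have hA₀ : |f₀| ≤ f₀ + f₁ := by rw [abs_of_pos hf₀]; linarith
  have hA₁ : |f₁| ≤ f₀ + f₁ := by rw [abs_of_pos hf₁]; linarith
  have hn : ((2 * k + 2 : ℕ) : ℝ) = 2 * k + 2 := by push_cast; ring
  constructor
  · obtain ⟨b, hb, hbA⟩ := exists_isDualCertCoeff (F := targetF t ε f₀ f₁ fbar) (c := 0)
      C.det_ne_zero
      (fun i => targetF_of_near (htb i).1.ne' (htb i).2.ne (i := i) (by simpa using hε.le))
      (by
        filter_upwards [eventually_nodes_near htb hε] with ρ hρ i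
        exact targetF_of_near (hρ i).1 (hρ i).2.1 (hρ i).2.2.le)
    refine ⟨b, hb, ?_⟩
    rw [show targetF t ε f₀ f₁ fbar 0 = f₀ by simp [targetF],
      show targetF t ε f₀ f₁ fbar 1 = f₁ by simp [targetF]] at hbA
    have h := norm_le_sqrt_mul_of_abs_le (by positivity)
      (C.abs_le_of_interior_eq_zero hbA hA₀ hA₁)
    rw [hn] at h
    have h4 : √(2 * k + 2) * 2 ≤ √((2 * k + 2) * (4 * k + 5 + 4 * k / σ ^ 4)) := by
      rw [Real.sqrt_mul (by positivity)]
      gcongr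
      refine Real.le_sqrt_of_sq_le ?_
      have : 0 ≤ 4 * k / σ ^ 4 := by positivity
      linarith
    have h5 : f₀ + f₁ ≤ Cbar f₀ f₁ ^ (5 / 4 : ℝ) :=
      le_trans (by linarith) (Real.self_le_rpow_of_one_le (by linarith) (by norm_num))
    calc ‖b‖ ≤ √(2 * k + 2) * 2 * 1 * (f₀ + f₁) * 1 := by linarith
      _ ≤ √((2 * k + 2) * (4 * k + 5 + 4 * k / σ ^ 4)) * E *
          Cbar f₀ f₁ ^ (5 / 4 : ℝ) * Fratio Δ σ ^ k := by
        have : 0 ≤ Cbar f₀ f₁ ^ (5 / 4 : ℝ) := by linarith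
        gcongr
        linarith
      _ = _ := by rw [← hE, mul_one_div]
  · intro π hπ
    have hΔε : 0 < Δ - ε := by linarith
    obtain ⟨b, hb, hbA⟩ := exists_isDualCertCoeff (F := targetFSign t π ε f₀ f₁ fbar) (c := π)
      C.det_ne_zero
      (fun i => targetFSign_of_near hΔ (htb i).1.ne' (htb i).2.ne (i := i)
        (by simpa using hε.le) (by simpa using hΔε))
      (by
        filter_upwards [eventually_nodes_near htb hε, eventually_nodes_near htb hΔε]
          with ρ hρ hρ' i
        exact targetFSign_of_near hΔ (hρ i).1 (hρ i).2.1 (hρ i).2.2.le (hρ' i).2.2)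
    refine ⟨b, hb, ?_⟩
    rw [show targetFSign t π ε f₀ f₁ fbar 0 = f₀ by simp [targetFSign],
      show targetFSign t π ε f₀ f₁ fbar 1 = f₁ by simp [targetFSign]] at hbA
    have h := norm_le_sqrt_mul_of_abs_le (by positivity)
      (C.abs_le_of_interior_le_one hbA hA₀ hA₁
        (fun i => by rcases hπ i with h | h <;> simp [h]))
    rw [hn] at h
    have h5 : 2 + (f₀ + f₁) ≤ (Cbar f₀ f₁ + 2 * k) ^ (3 / 2 : ℝ) :=
      le_trans (by linarith) (Real.self_le_rpow_of_one_le (by linarith) (by norm_num))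
    calc ‖b‖ ≤ √(2 * k + 2) / η * 4 * (2 + (f₀ + f₁)) * (1 / Fmin Δ σ) := by
          refine h.trans (le_of_eq ?_)
          field_simp
      _ ≤ √(2 * k + 2) / η * E *
          (Cbar f₀ f₁ + 2 * k) ^ (3 / 2 : ℝ) * Fratio Δ σ ^ k := by
        have : 0 ≤ (Cbar f₀ f₁ + 2 * k) ^ (3 / 2 : ℝ) := by linarith
        gcongr
      _ = _ := by rw [← hE, div_mul_div_comm, mul_one]
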